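/- Let $N\ge 1$, let $|E|$ denote the Lebesgue measure of $E\subset\mathbb R^N$, and let $\chi_E$ denote its characteristic function. For a measurable $f:\mathbb R^N\to\mathbb R$ let $$f^*(s)=\inf\{\lambda>0:\ |\{x:|f(x)|>\lambda\}|\le s\}\quad(\inf\emptyset=\infty),\qquad f^{**}(s)=\frac1s\int_0^s f^*(\tau)\,d\tau .$$ Let $\Phi:[0,\infty)\to\mathbb R$ be non-decreasing such that: $\Phi(0)=1$; there is $C>0$ with $\Phi(a^2)\le C\Phi(a)$ for all $a\ge 0$; and for every $\delta>0$ there are $C_\delta,\tau_\delta>0$ with $\tau_2^{-\delta}\Phi(\tau_2)\le C_\delta\tau_1^{-\delta}\Phi(\tau_1)$ whenever $\tau_\delta\le\tau_1\le\tau_2$. For $r\in[1,\infty)$, $\alpha\ge0$ set $$\|f\|_{L^{r,\infty}\Phi(L)^\alpha}=\sup_{s>0}\{s\,\Phi(s^{-1})^\alpha f^*(s)^r\}^{1/r},\qquad \|f\|_{\mathfrak L^{r,\infty}\Phi(\mathfrak L)^\alpha}=\sup_{s>0}\{s\,\Phi(s^{-1})^\alpha(|f|^r)^{**}(s)\}^{1/r},$$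 and let both be $\|f\|_{L^\infty}$ if $r=\infty$. For $R\in(0,\infty)$ set $$\|f\|_{\Phi,r,\alpha;R}=\sup_{x\in\mathbb R^N}\|f\chi_{B(x,R)}\|_{L^{r,\infty}\Phi(L)^\alpha},\qquad |||f|||_{\Phi,r,\alpha;R}=\sup_{x\in\mathbb R^N}\|f\chi_{B(x,R)}\|_{\mathfrak L^{r,\infty}\Phi(\mathfrak L)^\alpha},$$ where $B(x,R)$ is the open ball, and let $L^{r,\infty}_{\rm ul}\Phi(L)^\alpha$ (resp. $\mathfrak L^{r,\infty}_{\rm ul}\Phi(\mathfrak L)^\alpha$) be the set of locally integrable $f:\mathbb R^N\to\mathbb R$ with $\|f\|_{\Phi,r,\alpha;1}<\infty$ (resp. $|||f|||_{\Phi,r,\alpha;1}<\infty$). Let $$[S(t)\varphi](x)=\int_{\mathbb R^N}(4\pi t)^{-N/2}e^{-|x-y|^2/(4t)}\varphi(y)\,dy .$$ **Proposition 3.2.** Let $1\le r_1\le r_2\le\infty$, $\alpha,\beta\ge0$ and $R_*\in(0,\infty)$, and assume $\alpha\le\beta$ if $r_1=r_2$. (Here $1/\infty=0$.) 1. There exists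 $C_1>0$ such that, for all $\varphi\in\mathfrak L^{r_1,\infty}_{\rm ul}\Phi(\mathfrak L)^\alpha$, $R\in(0,R_*]$ and $t\in(0,R^2)$, $$|||S(t)\varphi|||_{\Phi,r_2,\beta;R}\le C_1\,t^{-\frac N2\left(\frac1{r_1}-\frac1{r_2}\right)}\,\Phi(t^{-1})^{-\frac{\alpha}{r_1}+\frac{\beta}{r_2}}\,|||\varphi|||_{\Phi,r_1,\alpha;R}.$$ 2. If $r_1>1$, there exists $C_2>0$ such that, for all $\varphi\in L^{r_1,\infty}_{\rm ul}\Phi(L)^\alpha$, $R\in(0,R_*]$ and $t\in(0,R^2)$, $$\|S(t)\varphi\|_{\Phi,r_2,\beta;R}\le C_2\,t^{-\frac N2\left(\frac1{r_1}-\frac1{r_2}\right)}\,\Phi(t^{-1})^{-\frac{\alpha}{r_1}+\frac{\beta}{r_2}}\,\|\varphi\|_{\Phi,r_1,\alpha;R}.$$ 3. If $1<r_1<r_2$, there exists $C_3>0$ such that, for all $\varphi\in L^{r_1,\infty}_{\rm ul}\Phi(L)^\alpha$, $R\in(0,R_*]$ and $t\in(0,R^2)$, $$|||S(t)\varphi|||_{\Phi,r_2,\beta;R}\le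 C_3\,t^{-\frac N2\left(\frac1{r_1}-\frac1{r_2}\right)}\,\Phi(t^{-1})^{-\frac{\alpha}{r_1}+\frac{\beta}{r_2}}\,\|\varphi\|_{\Phi,r_1,\alpha;R}.$$ In each case the integral defining $[S(t)\varphi](x)$ converges absolutely for every $x\in\mathbb R^N$. -/

import Mathlib

open MeasureTheory
open scoped ENNReal

noncomputable section

/-- The class of weights: `Φ` is non-decreasing on `[0, ∞)`, `Φ 0 = 1`,
`Φ (a ^ 2) ≤ C Φ a`, and `τ ↦ τ ^ (-δ) Φ τ` is almost decreasing near infinity for all `δ > 0`.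
Only the values of `Φ` on `[0, ∞)` matter. -/
structure IsZygmundWeight (Φ : ℝ → ℝ) : Prop where
  monotoneOn : MonotoneOn Φ (Set.Ici 0)
  map_zero : Φ 0 = 1
  sq_le : ∃ C : ℝ, 0 < C ∧ ∀ a : ℝ, 0 ≤ a → Φ (a ^ 2) ≤ C * Φ a
  almost_decreasing : ∀ δ : ℝ, 0 < δ → ∃ C τ₀ : ℝ, 0 < C ∧ 0 < τ₀ ∧
    ∀ τ₁ τ₂ : ℝ, τ₀ ≤ τ₁ → τ₁ ≤ τ₂ → τ₂ ^ (-δ) * Φ τ₂ ≤ C * (τ₁ ^ (-δ) * Φ τ₁)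

/-- The distribution function `l ↦ |{x : |f x| > l}|`. -/
def distribFun {N : ℕ} (f : EuclideanSpace ℝ (Fin N) → ℝ) (l : ℝ) : ℝ≥0∞ :=
  volume {x | l < |f x|}

/-- The non-increasing rearrangement `f* s = inf {l > 0 : |{|f| > l}| ≤ s}`, with `inf ∅ = ∞`. -/
def rearr {N : ℕ} (f : EuclideanSpace ℝ (Fin N) → ℝ) (s : ℝ) : ℝ≥0∞ :=
  ⨅ (l : ℝ) (_ : 0 < l) (_ : distribFun f l ≤ ENNReal.ofReal s), ENNReal.ofReal l

/-- The averaged rearrangement `f** s = s⁻¹ ∫₀ˢ f* τ dτ`, for `s > 0`. -/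
def rearrAvg {N : ℕ} (f : EuclideanSpace ℝ (Fin N) → ℝ) (s : ℝ) : ℝ≥0∞ :=
  (ENNReal.ofReal s)⁻¹ * ∫⁻ τ in Set.Ioo 0 s, rearr f τ

/-- The weak Zygmund norm of `L^{r,∞} Φ(L)^α`:
`sup_{s>0} {s Φ(s⁻¹)^α (f* s)^r}^{1/r}` if `r < ∞`, and the `L^∞` norm if `r = ∞`. -/
def weakZygmundNorm {N : ℕ} (Φ : ℝ → ℝ) (r : ℝ≥0∞) (α : ℝ)
    (f : EuclideanSpace ℝ (Fin N) → ℝ) : ℝ≥0∞ :=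
  if r = ∞ then eLpNorm f ∞ volume
  else ⨆ (s : ℝ) (_ : 0 < s),
    (ENNReal.ofReal (s * Φ s⁻¹ ^ α) * rearr f s ^ r.toReal) ^ (1 / r.toReal)

/-- The averaged weak Zygmund norm of `𝔏^{r,∞} Φ(𝔏)^α`:
`sup_{s>0} {s Φ(s⁻¹)^α (|f|^r)** s}^{1/r}` if `r < ∞`, and the `L^∞` norm if `r = ∞`. -/
def avgZygmundNorm {N : ℕ} (Φ : ℝ → ℝ) (r : ℝ≥0∞) (α : ℝ)
    (f : EuclideanSpace ℝ (Fin N) → ℝ) : ℝ≥0∞ :=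
  if r = ∞ then eLpNorm f ∞ volume
  else ⨆ (s : ℝ) (_ : 0 < s),
    (ENNReal.ofReal (s * Φ s⁻¹ ^ α) * rearrAvg (fun x => |f x| ^ r.toReal) s) ^ (1 / r.toReal)

/-- `‖f‖_{Φ,r,α;R}`: the supremum over the centres `x` of the weak Zygmund norm of `f χ_{B(x,R)}`. -/
def ulWeakZygmundNorm {N : ℕ} (Φ : ℝ → ℝ) (r : ℝ≥0∞) (α R : ℝ)
    (f : EuclideanSpace ℝ (Fin N) → ℝ) : ℝ≥0∞ :=
  ⨆ x : EuclideanSpace ℝ (Fin N), weakZygmundNorm Φ r α ((Metric.ball x R).indicator f)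

/-- `|||f|||_{Φ,r,α;R}`: the supremum over the centres `x` of the averaged weak Zygmund norm of
`f χ_{B(x,R)}`. -/
def ulAvgZygmundNorm {N : ℕ} (Φ : ℝ → ℝ) (r : ℝ≥0∞) (α R : ℝ)
    (f : EuclideanSpace ℝ (Fin N) → ℝ) : ℝ≥0∞ :=
  ⨆ x : EuclideanSpace ℝ (Fin N), avgZygmundNorm Φ r α ((Metric.ball x R).indicator f)

/-- Membership in the uniformly local space `L_ul^{r,∞} Φ(L)^α`. -/
def MemUlWeakZygmund {N : ℕ} (Φ : ℝ → ℝ) (r : ℝ≥0∞) (α : ℝ)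
    (f : EuclideanSpace ℝ (Fin N) → ℝ) : Prop :=
  LocallyIntegrable f volume ∧ ulWeakZygmundNorm Φ r α 1 f < ∞

/-- Membership in the uniformly local space `𝔏_ul^{r,∞} Φ(𝔏)^α`. -/
def MemUlAvgZygmund {N : ℕ} (Φ : ℝ → ℝ) (r : ℝ≥0∞) (α : ℝ)
    (f : EuclideanSpace ℝ (Fin N) → ℝ) : Prop :=
  LocallyIntegrable f volume ∧ ulAvgZygmundNorm Φ r α 1 f < ∞

/-- The Gauss kernel `G(x,t) = (4πt)^{-N/2} exp(-|x|²/(4t))`. -/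
def gaussKernel {N : ℕ} (x : EuclideanSpace ℝ (Fin N)) (t : ℝ) : ℝ :=
  (4 * Real.pi * t) ^ (-((N : ℝ) / 2)) * Real.exp (-(‖x‖ ^ 2 / (4 * t)))

/-- The heat semigroup `[S(t)φ](x) = ∫ G(x - y, t) φ(y) dy`. -/
def heatSemigroup {N : ℕ} (t : ℝ) (φ : EuclideanSpace ℝ (Fin N) → ℝ)
    (x : EuclideanSpace ℝ (Fin N)) : ℝ :=
  ∫ y, gaussKernel (x - y) t * φ y

/-- The integral defining `[S(t)φ](x)` converges absolutely for every `x`. -/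
def HeatIntegrable {N : ℕ} (t : ℝ) (φ : EuclideanSpace ℝ (Fin N) → ℝ) : Prop :=
  ∀ x : EuclideanSpace ℝ (Fin N), Integrable (fun y => gaussKernel (x - y) t * φ y) volume

/-- The decay rate `t^{-(N/2)(1/r₁ - 1/r₂)} Φ(t⁻¹)^{-α/r₁ + β/r₂}`, with `1/∞ = 0`. -/
def decayRate (N : ℕ) (Φ : ℝ → ℝ) (r₁ r₂ : ℝ≥0∞) (α β t : ℝ) : ℝ :=
  t ^ (-((N : ℝ) / 2) * (r₁⁻¹.toReal - r₂⁻¹.toReal)) *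
    Φ t⁻¹ ^ (-(α * r₁⁻¹.toReal) + β * r₂⁻¹.toReal)

end

/-! ### Rearrangements -/

/-! Both norms of `φ` are converted into one kind of information, a `MassBound`: on a measurable set
of measure at most `s` inside any ball of radius `R`, `∫ |φ|^p ≤ s (A P(s))^p`, where `P` is
`zygmundProfile` and `A` is a norm of `φ`, up to a constant. The averaged norm gives this with `p =
r₁` by Hardy–Littlewood. The weak norm gives it only with `p = 1`, by integrating `P`, which is
where `r₁ > 1` enters.

The heat flow acts well on such bounds. The Gaussian is a probability density, so by Jensen and
translation invariance `u = S(t)φ` inherits the mass bound without loss (`massBound_heatSemigroup`).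
A Gaussian average is also dominated by averages over balls of radius comparable to `√t ≤ R`, so
`|u| ≤ C A P(T)` everywhere, with `T = t^{N/2}` (`exists_enorm_heatSemigroup_le`). Testing the mass
bound on pieces of level sets gives `u* ≤ C A P` on each ball, and a similar bound for the averaged
rearrangement.

It remains to measure `min(P(s), P(T))` in the target norm. If `r₁ < r₂`, its power `r₂` decays like
`τ^{-r₂/r₁}` up to the weight, hence is integrable at infinity, and the averaged norm is reached
even from weak data (`exists_lintegral_le`). If `r₁ = r₂`, the comparison is made at each `s`, and
`α ≤ β` makes the ratio of weights monotone (`exists_mul_le`). Finally `Φ(a²) ≤ C Φ(a)` replaces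
`Φ(T⁻¹)` by `Φ(t⁻¹)`. -/

theorem distribFun_antitone {N : ℕ} (f : EuclideanSpace ℝ (Fin N) → ℝ) :
    Antitone (distribFun f) :=
  fun _ _ h => measure_mono fun _ hx => lt_of_le_of_lt h hx

theorem rearr_antitone {N : ℕ} (f : EuclideanSpace ℝ (Fin N) → ℝ) : Antitone (rearr f) := by
  intro a b h
  refine le_iInf fun l => le_iInf fun hl => le_iInf fun hD => ?_
  exact iInf_le_of_le l (iInf_le_of_le hl (iInf_le _ (hD.trans (ENNReal.ofReal_le_ofReal h))))

theorem rearr_le_of_distribFun_le {N : ℕ} {f : EuclideanSpace ℝ (Fin N) → ℝ} {s l : ℝ}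
    (hl : 0 < l) (hD : distribFun f l ≤ ENNReal.ofReal s) : rearr f s ≤ ENNReal.ofReal l :=
  iInf_le_of_le l (iInf_le_of_le hl (iInf_le _ hD))

theorem distribFun_le_of_rearr_lt {N : ℕ} {f : EuclideanSpace ℝ (Fin N) → ℝ} {s l : ℝ}
    (h : rearr f s < ENNReal.ofReal l) : distribFun f l ≤ ENNReal.ofReal s := by
  simp only [rearr, iInf_lt_iff] at h
  obtain ⟨l', hl', hD, hlt⟩ := h
  exact (distribFun_antitone f (ENNReal.ofReal_lt_ofReal_iff'.1 hlt).1.le).trans hD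

/-- The distribution function is antitone, so this set of levels is an interval with left end `0`,
and its length is the infimum defining `f*`. Written as a measure, `f*` becomes accessible to
Tonelli. -/
theorem rearr_eq_volume {N : ℕ} (f : EuclideanSpace ℝ (Fin N) → ℝ) (s : ℝ) :
    rearr f s = volume {l : ℝ | 0 < l ∧ ENNReal.ofReal s < distribFun f l} := by
  apply le_antisymm
  · refine le_of_forall_gt fun c hc => ?_
    obtain ⟨l, hl, hlc⟩ := ENNReal.lt_iff_exists_nnreal_btwn.1 hc
    refine lt_of_le_of_lt ?_ hlc
    rw [← ENNReal.ofReal_coe_nnreal] at hl ⊢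
    have hl0 : (0 : ℝ) < l := ENNReal.ofReal_pos.1 (lt_of_le_of_lt zero_le hl)
    refine rearr_le_of_distribFun_le hl0 (not_lt.1 fun hD => ?_)
    refine (lt_irrefl _ (lt_of_le_of_lt ?_ hl))
    calc ENNReal.ofReal l = volume (Set.Ioc (0 : ℝ) l) := by simp
      _ ≤ _ := measure_mono (by
          rintro x ⟨hx0, hx⟩
          exact ⟨hx0, hD.trans_le (distribFun_antitone f hx)⟩)
  · refine le_iInf fun l => le_iInf fun hl => le_iInf fun hD => ?_
    calc _ ≤ volume (Set.Ioc (0 : ℝ) l) := measure_mono (by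
          rintro x ⟨hx0, hx⟩
          exact ⟨hx0, le_of_lt (not_le.1 fun h =>
            (hx.trans_le ((distribFun_antitone f h).trans hD)).false)⟩)
      _ = _ := by simp

/-- Tonelli for the region `τ < |{|f| > l}|` in `(0, s) × (0, ∞)`: its slice at fixed `l` has length
`min(s, |{|f| > l}|)`. -/
theorem lintegral_rearr {N : ℕ} (f : EuclideanSpace ℝ (Fin N) → ℝ) (s : ℝ) :
    ∫⁻ τ in Set.Ioo 0 s, rearr f τ
      = ∫⁻ l in Set.Ioi (0 : ℝ), min (ENNReal.ofReal s) (distribFun f l) := by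
  have hDm : Measurable (distribFun f) := (distribFun_antitone f).measurable
  have hS : MeasurableSet {p : ℝ × ℝ | ENNReal.ofReal p.1 < distribFun f p.2} :=
    measurableSet_lt (ENNReal.measurable_ofReal.comp measurable_fst) (hDm.comp measurable_snd)
  have h1 : ∀ τ, rearr f τ = ∫⁻ l in Set.Ioi (0 : ℝ),
      {p : ℝ × ℝ | ENNReal.ofReal p.1 < distribFun f p.2}.indicator 1 (τ, l) := by
    intro τ
    have hm : MeasurableSet {l : ℝ | ENNReal.ofReal τ < distribFun f l} :=
      measurableSet_lt measurable_const hDm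
    rw [rearr_eq_volume]
    have : ∀ l, {p : ℝ × ℝ | ENNReal.ofReal p.1 < distribFun f p.2}.indicator
        (1 : ℝ × ℝ → ℝ≥0∞) (τ, l)
        = {l : ℝ | ENNReal.ofReal τ < distribFun f l}.indicator 1 l := fun l => rfl
    simp_rw [this]
    rw [lintegral_indicator_one hm, Measure.restrict_apply hm]
    congr 1
    ext l
    simp [and_comm]
  simp_rw [h1]
  rw [lintegral_lintegral_swap (f := fun τ l => {p : ℝ × ℝ |
    ENNReal.ofReal p.1 < distribFun f p.2}.indicator (1 : ℝ × ℝ → ℝ≥0∞) (τ, l))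
    ((measurable_one.indicator hS).aemeasurable)]
  refine lintegral_congr fun l => ?_
  have hm : MeasurableSet {τ : ℝ | ENNReal.ofReal τ < distribFun f l} :=
      measurableSet_lt ENNReal.measurable_ofReal measurable_const
  have : ∀ τ, {p : ℝ × ℝ | ENNReal.ofReal p.1 < distribFun f p.2}.indicator
        (1 : ℝ × ℝ → ℝ≥0∞) (τ, l)
        = {τ : ℝ | ENNReal.ofReal τ < distribFun f l}.indicator 1 τ := fun l => rfl
  simp_rw [this]
  rw [lintegral_indicator_one hm, Measure.restrict_apply hm]
  by_cases hD : distribFun f l = ∞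
  · simp [hD]
  · have : {τ : ℝ | ENNReal.ofReal τ < distribFun f l} ∩ Set.Ioo 0 s
        = Set.Ioo 0 (min s (distribFun f l).toReal) := by
      ext τ
      simp only [Set.mem_inter_iff, Set.mem_ofPred_eq, Set.mem_Ioo, lt_min_iff]
      constructor
      · rintro ⟨h, h0, hs⟩
        exact ⟨h0, hs, (ENNReal.ofReal_lt_iff_lt_toReal h0.le hD).1 h⟩
      · rintro ⟨h0, hs, h⟩
        exact ⟨(ENNReal.ofReal_lt_iff_lt_toReal h0.le hD).2 h, h0, hs⟩
    rw [this, Real.volume_Ioo, sub_zero, ENNReal.ofReal_min, ENNReal.ofReal_toReal hD]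

/-- The Hardy–Littlewood inequality for characteristic functions. -/
theorem setLIntegral_le_lintegral_rearr {N : ℕ} {f : EuclideanSpace ℝ (Fin N) → ℝ}
    (hf : AEMeasurable f) {E : Set (EuclideanSpace ℝ (Fin N))} {s : ℝ}
    (hE : volume E ≤ ENNReal.ofReal s) :
    ∫⁻ y in E, ‖f y‖ₑ ≤ ∫⁻ τ in Set.Ioo 0 s, rearr f τ := by
  rw [lintegral_rearr]
  simp_rw [Real.enorm_eq_ofReal_abs]
  rw [lintegral_eq_lintegral_meas_lt _ (Filter.Eventually.of_forall fun x => abs_nonneg _)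
    hf.restrict.abs]
  refine lintegral_mono fun l => le_min ?_ ?_
  · exact (measure_mono (Set.subset_univ _)).trans (by simpa using hE)
  · exact Measure.restrict_apply_le _ _

/-- Split the layer-cake integral at level `a`: below, the integrand is at most `s`; above, only the
part of `f` on `{|f| > a}` is seen. -/
theorem lintegral_rearr_le {N : ℕ} {f : EuclideanSpace ℝ (Fin N) → ℝ}
    (hf : Measurable f) (s : ℝ) {a : ℝ} (ha : 0 < a) :
    ∫⁻ τ in Set.Ioo 0 s, rearr f τ
      ≤ ENNReal.ofReal s * ENNReal.ofReal a + ∫⁻ y in {y | a < |f y|}, ‖f y‖ₑ := by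
  rw [lintegral_rearr]
  simp_rw [Real.enorm_eq_ofReal_abs]
  rw [lintegral_eq_lintegral_meas_lt _ (Filter.Eventually.of_forall fun x => abs_nonneg _)
    hf.aemeasurable.restrict.abs, ← Set.Ioc_union_Ioi_eq_Ioi ha.le]
  rw [lintegral_union measurableSet_Ioi (Set.Ioc_disjoint_Ioi_same),
    lintegral_union measurableSet_Ioi (Set.Ioc_disjoint_Ioi_same)]
  refine add_le_add ?_ (le_add_left ?_)
  · calc _ ≤ ∫⁻ l in Set.Ioc 0 a, ENNReal.ofReal s := lintegral_mono fun l => min_le_left _ _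
      _ = _ := by simp
  · refine setLIntegral_mono' measurableSet_Ioi fun l hl => (min_le_right _ _).trans ?_
    rw [Measure.restrict_apply (measurableSet_lt measurable_const hf.abs)]
    exact measure_mono fun y hy => ⟨hy, lt_trans (Set.mem_Ioi.1 hl) hy⟩

theorem mul_rearr_le_lintegral {N : ℕ} (f : EuclideanSpace ℝ (Fin N) → ℝ) (s : ℝ) :
    ENNReal.ofReal s * rearr f s ≤ ∫⁻ τ in Set.Ioo 0 s, rearr f τ := by
  calc ENNReal.ofReal s * rearr f s = ∫⁻ τ in Set.Ioo 0 s, rearr f s := by simp [mul_comm]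
    _ ≤ _ := setLIntegral_mono' measurableSet_Ioo fun τ hτ => rearr_antitone f hτ.2.le

theorem rearr_le_rearrAvg {N : ℕ} (f : EuclideanSpace ℝ (Fin N) → ℝ) {s : ℝ} (hs : 0 < s) :
    rearr f s ≤ rearrAvg f s := by
  rw [rearrAvg, mul_comm, ← div_eq_mul_inv, ENNReal.le_div_iff_mul_le
    (Or.inl (by simpa using hs)) (Or.inl ENNReal.ofReal_ne_top), mul_comm]
  exact mul_rearr_le_lintegral f s

theorem distribFun_abs_rpow {N : ℕ} (f : EuclideanSpace ℝ (Fin N) → ℝ) {p l : ℝ} (hp : 0 < p)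
    (hl : 0 < l) : distribFun (fun x => |f x| ^ p) (l ^ p) = distribFun f l := by
  simp only [distribFun]
  congr 1
  ext x
  simp only [Set.mem_ofPred_eq]
  rw [abs_of_nonneg (Real.rpow_nonneg (abs_nonneg _) _),
    Real.rpow_lt_rpow_iff hl.le (abs_nonneg _) hp]

theorem rearr_abs_rpow {N : ℕ} (f : EuclideanSpace ℝ (Fin N) → ℝ) {p : ℝ} (hp : 0 < p) (s : ℝ) :
    rearr (fun x => |f x| ^ p) s = rearr f s ^ p := by
  apply le_antisymm
  · rw [← ENNReal.rpow_inv_le_iff hp]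
    refine le_iInf fun l => le_iInf fun hl => le_iInf fun hD => ?_
    rw [ENNReal.rpow_inv_le_iff hp, ENNReal.ofReal_rpow_of_pos hl]
    exact rearr_le_of_distribFun_le (Real.rpow_pos_of_pos hl _)
      ((distribFun_abs_rpow f hp hl).trans_le hD)
  · refine le_iInf fun l => le_iInf fun hl => le_iInf fun hD => ?_
    have hl' : 0 < l ^ p⁻¹ := Real.rpow_pos_of_pos hl _
    have he : (l ^ p⁻¹) ^ p = l := Real.rpow_inv_rpow hl.le hp.ne'
    rw [← he, distribFun_abs_rpow f hp hl'] at hD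
    calc rearr f s ^ p ≤ ENNReal.ofReal (l ^ p⁻¹) ^ p :=
          ENNReal.rpow_le_rpow (rearr_le_of_distribFun_le hl' hD) hp.le
      _ = _ := by rw [ENNReal.ofReal_rpow_of_pos hl', he]

theorem rearr_le_of_enorm_le {N : ℕ} {f : EuclideanSpace ℝ (Fin N) → ℝ} {M : ℝ≥0∞}
    (h : ∀ x, ‖f x‖ₑ ≤ M) (s : ℝ) : rearr f s ≤ M := by
  refine le_of_forall_gt fun c hc => ?_
  obtain ⟨l, hl, hlc⟩ := ENNReal.lt_iff_exists_nnreal_btwn.1 hc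
  refine lt_of_le_of_lt ?_ hlc
  rw [← ENNReal.ofReal_coe_nnreal] at hl ⊢
  have hl0 : (0 : ℝ) < l := ENNReal.ofReal_pos.1 (lt_of_le_of_lt zero_le hl)
  refine rearr_le_of_distribFun_le hl0 ?_
  have : {x | (l : ℝ) < |f x|} = ∅ := by
    ext x
    simp only [Set.mem_ofPred_eq, Set.mem_empty_iff_false, iff_false, not_lt]
    have := ((h x).trans hl.le)
    rw [Real.enorm_eq_ofReal_abs] at this
    exact (ENNReal.ofReal_le_ofReal_iff hl0.le).1 this
  rw [distribFun, this]
  simp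

/-! ### Subsets of prescribed measure -/

/-- Sweep `A` by concentric balls: spheres are null when `N ≥ 1`, so the swept volume depends
continuously on the radius and takes every intermediate value. The radius used is the supremum of
those whose swept volume is at most `s`. -/
theorem exists_measurable_subset_volume_eq {N : ℕ} (hN : 1 ≤ N)
    {A : Set (EuclideanSpace ℝ (Fin N))} (hA : MeasurableSet A)
    {x : EuclideanSpace ℝ (Fin N)} {R s : ℝ} (hAR : A ⊆ Metric.ball x R)
    (hsA : ENNReal.ofReal s ≤ volume A) :
    ∃ E ⊆ A, MeasurableSet E ∧ volume E = ENNReal.ofReal s := by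
  have : Nonempty (Fin N) := ⟨⟨0, hN⟩⟩
  have hfin : volume A ≠ ∞ := ((measure_mono hAR).trans_lt measure_ball_lt_top).ne
  set F : ℝ → ℝ≥0∞ := fun ρ => volume (A ∩ Metric.ball x ρ) with hF
  have hFmono : Monotone F := fun a b h =>
    measure_mono (Set.inter_subset_inter_right _ (Metric.ball_subset_ball h))
  by_cases hsA' : ENNReal.ofReal s = volume A
  · exact ⟨A, subset_rfl, hA, hsA'.symm⟩
  have hlt : ENNReal.ofReal s < volume A := lt_of_le_of_ne hsA hsA'
  set S : Set ℝ := {ρ | F ρ ≤ ENNReal.ofReal s} with hS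
  have h0 : (0 : ℝ) ∈ S := by simp [hS, hF]
  have hbdd : BddAbove S := ⟨R, fun ρ hρ => not_lt.1 fun h => by
    have hsub : A ⊆ A ∩ Metric.ball x ρ :=
      Set.subset_inter subset_rfl (hAR.trans (Metric.ball_subset_ball h.le))
    exact (lt_of_le_of_lt ((measure_mono hsub).trans hρ) hlt).false⟩
  set ρ₀ := sSup S
  refine ⟨A ∩ Metric.ball x ρ₀, Set.inter_subset_left, hA.inter measurableSet_ball,
    le_antisymm ?_ ?_⟩
  · obtain ⟨u, hu, hulim, huS⟩ := exists_seq_tendsto_sSup ⟨0, h0⟩ hbdd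
    have : A ∩ Metric.ball x ρ₀ ⊆ ⋃ n, A ∩ Metric.ball x (u n) := by
      rintro y ⟨hyA, hy⟩
      obtain ⟨n, hn⟩ := (hulim.eventually (lt_mem_nhds (Metric.mem_ball.1 hy))).exists
      exact Set.mem_iUnion.2 ⟨n, hyA, hn⟩
    refine (measure_mono this).trans ?_
    rw [Monotone.measure_iUnion (fun a b h =>
      Set.inter_subset_inter_right _ (Metric.ball_subset_ball (hu h)))]
    exact iSup_le fun n => huS n
  · have hnull : volume (A ∩ Metric.closedBall x ρ₀) ≤ volume (A ∩ Metric.ball x ρ₀) := by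
      rw [← Metric.ball_union_sphere, Set.inter_union_distrib_left]
      refine (measure_union_le _ _).trans ?_
      rw [measure_mono_null Set.inter_subset_right (Measure.addHaar_sphere volume x ρ₀), add_zero]
    refine le_trans ?_ hnull
    have hInter : A ∩ Metric.closedBall x ρ₀
        = ⋂ n : ℕ, A ∩ Metric.ball x (ρ₀ + 1 / ((n : ℝ) + 1)) := by
      ext y
      simp only [Set.mem_inter_iff, Metric.mem_closedBall, Set.mem_iInter, Metric.mem_ball]
      constructor
      · rintro ⟨h1, h2⟩ n
        exact ⟨h1, lt_of_le_of_lt h2 (by simp; positivity)⟩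
      · intro h
        refine ⟨(h 0).1, le_of_forall_pos_lt_add fun ε hε => ?_⟩
        obtain ⟨n, hn⟩ := exists_nat_one_div_lt hε
        linarith [(h n).2]
    rw [hInter, Antitone.measure_iInter]
    · refine le_iInf fun n => le_of_lt (not_le.1 fun h => ?_)
      have := le_csSup hbdd (show ρ₀ + 1 / ((n : ℝ) + 1) ∈ S from h)
      have h3 : (0 : ℝ) < 1 / ((n : ℝ) + 1) := by positivity
      linarith
    · intro a b h
      refine Set.inter_subset_inter_right _ (Metric.ball_subset_ball ?_)
      have : 1 / ((b : ℝ) + 1) ≤ 1 / ((a : ℝ) + 1) := by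
        apply one_div_le_one_div_of_le (by positivity); exact_mod_cast Nat.succ_le_succ h
      linarith
    · exact fun n => (hA.inter measurableSet_ball).nullMeasurableSet
    · exact ⟨0, ((measure_mono Set.inter_subset_left).trans_lt hfin.lt_top).ne⟩


/-! ### The heat kernel -/

theorem gaussKernel_nonneg {N : ℕ} (x : EuclideanSpace ℝ (Fin N)) {t : ℝ} (ht : 0 < t) :
    0 ≤ gaussKernel x t := by
  unfold gaussKernel; positivity

theorem continuous_gaussKernel {N : ℕ} (t : ℝ) :
    Continuous fun x : EuclideanSpace ℝ (Fin N) => gaussKernel x t := by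
  unfold gaussKernel; fun_prop

theorem lintegral_gaussKernel {N : ℕ} {t : ℝ} (ht : 0 < t) :
    ∫⁻ x : EuclideanSpace ℝ (Fin N), ENNReal.ofReal (gaussKernel x t) = 1 := by
  have hint : Integrable (fun x : EuclideanSpace ℝ (Fin N) => gaussKernel x t) := by
    have := (GaussianFourier.integrable_cexp_neg_mul_sq_norm_add
      (V := EuclideanSpace ℝ (Fin N)) (b := ((1 / (4 * t) : ℝ) : ℂ)) (by
        rw [Complex.ofReal_re]; positivity) 0 0).norm
    refine (this.const_mul ((4 * Real.pi * t) ^ (-((N : ℝ) / 2)))).congr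
      (Filter.Eventually.of_forall fun x => ?_)
    simp only [gaussKernel, zero_mul, add_zero, Complex.norm_exp]
    congr 2
    rw [← Complex.ofReal_pow, ← Complex.ofReal_neg, ← Complex.ofReal_mul, Complex.ofReal_re]
    ring
  rw [← ofReal_integral_eq_lintegral_ofReal hint
    (Filter.Eventually.of_forall fun x => gaussKernel_nonneg x ht)]
  have h1 : ∫ x : EuclideanSpace ℝ (Fin N), gaussKernel x t
      = (4 * Real.pi * t) ^ (-((N : ℝ) / 2)) *
        ∫ x : EuclideanSpace ℝ (Fin N), Real.exp (-(1 / (4 * t)) * ‖x‖ ^ 2) := by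
    rw [← integral_const_mul]
    congr 1
    ext x
    simp only [gaussKernel]
    congr 2
    ring
  rw [h1, GaussianFourier.integral_rexp_neg_mul_sq_norm (by positivity)]
  have h2 : Real.pi / (1 / (4 * t)) = 4 * Real.pi * t := by field_simp
  rw [h2, finrank_euclideanSpace_fin, ← Real.rpow_add (by positivity)]
  simp

/-- Doubling the time absorbs a shift of length at most `√t`: `‖y‖² ≤ 2‖x‖² + 2t` costs `e^{1/4}` in
the exponential, and the prefactor costs `2^{N/2}`. -/
theorem gaussKernel_le {N : ℕ} {t ρ : ℝ} (ht : 0 < t) (hρ : 0 ≤ ρ) (hρt : ρ ^ 2 ≤ t)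
    {x y : EuclideanSpace ℝ (Fin N)} (hxy : ‖x - y‖ ≤ ρ) :
    gaussKernel x t ≤ Real.exp (1 / 4) * 2 ^ ((N : ℝ) / 2) * gaussKernel y (2 * t) := by
  have h1 : (4 * Real.pi * (2 * t)) ^ (-((N : ℝ) / 2))
      = 2 ^ (-((N : ℝ) / 2)) * (4 * Real.pi * t) ^ (-((N : ℝ) / 2)) := by
    rw [← Real.mul_rpow (by norm_num) (by positivity)]; ring_nf
  have h2 : (2 : ℝ) ^ ((N : ℝ) / 2) * 2 ^ (-((N : ℝ) / 2)) = 1 := by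
    rw [← Real.rpow_add (by norm_num)]; simp
  have h3 : ‖y‖ ^ 2 ≤ 2 * ‖x‖ ^ 2 + 2 * t := by
    have h4 : ‖y‖ ≤ ‖x‖ + ρ := by
      have := norm_sub_le x (x - y)
      rw [sub_sub_cancel] at this
      linarith
    nlinarith [norm_nonneg x, norm_nonneg y, sq_nonneg (‖x‖ - ρ)]
  have h5 : Real.exp (-(‖x‖ ^ 2 / (4 * t)))
      ≤ Real.exp (1 / 4) * Real.exp (-(‖y‖ ^ 2 / (4 * (2 * t)))) := by
    rw [← Real.exp_add]
    refine Real.exp_le_exp.2 ?_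
    have h6 : ‖y‖ ^ 2 / (4 * (2 * t)) ≤ (2 * ‖x‖ ^ 2 + 2 * t) / (4 * (2 * t)) := by gcongr
    have h7 : (2 * ‖x‖ ^ 2 + 2 * t) / (4 * (2 * t)) = ‖x‖ ^ 2 / (4 * t) + 1 / 4 := by
      field_simp
    linarith
  unfold gaussKernel
  rw [h1]
  calc (4 * Real.pi * t) ^ (-((N : ℝ) / 2)) * Real.exp (-(‖x‖ ^ 2 / (4 * t)))
      ≤ (4 * Real.pi * t) ^ (-((N : ℝ) / 2)) *
        (Real.exp (1 / 4) * Real.exp (-(‖y‖ ^ 2 / (4 * (2 * t))))) := by gcongr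
    _ = (2 ^ ((N : ℝ) / 2) * 2 ^ (-((N : ℝ) / 2))) * ((4 * Real.pi * t) ^ (-((N : ℝ) / 2)) *
        (Real.exp (1 / 4) * Real.exp (-(‖y‖ ^ 2 / (4 * (2 * t)))))) := by rw [h2, one_mul]
    _ = _ := by ring

/-- A Gaussian average is controlled by the masses on balls of radius at most `√t`. -/
theorem lintegral_gaussKernel_mul_le {N : ℕ} {t ρ : ℝ} (ht : 0 < t) (hρ : 0 < ρ)
    (hρt : ρ ^ 2 ≤ t) {g : EuclideanSpace ℝ (Fin N) → ℝ≥0∞} (hg : Measurable g) {K : ℝ≥0∞}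
    (hK : ∀ z, ∫⁻ y in Metric.ball z ρ, g y ≤ K) (x : EuclideanSpace ℝ (Fin N)) :
    ∫⁻ y, ENNReal.ofReal (gaussKernel (x - y) t) * g y
      ≤ ENNReal.ofReal (Real.exp (1 / 4) * 2 ^ ((N : ℝ) / 2))
        * (volume (Metric.ball (0 : EuclideanSpace ℝ (Fin N)) ρ))⁻¹ * K := by
  set V := volume (Metric.ball (0 : EuclideanSpace ℝ (Fin N)) ρ) with hV
  set c := ENNReal.ofReal (Real.exp (1 / 4) * 2 ^ ((N : ℝ) / 2))
  have hV0 : V ≠ 0 := (Metric.measure_ball_pos _ _ hρ).ne'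
  have hVt : V ≠ ∞ := measure_ball_lt_top.ne
  set G : EuclideanSpace ℝ (Fin N) → ℝ≥0∞ := fun y => ENNReal.ofReal (gaussKernel (x - y) t)
  have hGm : Measurable G :=
    (((continuous_gaussKernel t).comp (continuous_const.sub continuous_id)).measurable).ennreal_ofReal
  have hDm : MeasurableSet {p : EuclideanSpace ℝ (Fin N) × EuclideanSpace ℝ (Fin N) |
      dist p.2 p.1 < ρ} :=
    measurableSet_lt (measurable_snd.dist measurable_fst) measurable_const
  have hball : ∀ y : EuclideanSpace ℝ (Fin N), volume (Metric.ball y ρ) = V := fun y => by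
    rw [hV, Measure.addHaar_ball_center]
  -- Write `V` as the integral over `z` of the indicator of `|z - y| < ρ` and swap. On `B(z, ρ)` the
  -- kernel is at most `c` times the time-`2t` kernel at `z`, which leaves the mass of `g` on that
  -- ball; the time-`2t` kernel integrates to one.
  have key : V * ∫⁻ y, G y * g y ≤ c * K := by
    calc V * ∫⁻ y, G y * g y = ∫⁻ y, ∫⁻ z, (Metric.ball y ρ).indicator 1 z * (G y * g y) := by
          rw [← lintegral_const_mul (f := fun y => G y * g y) _ (hGm.mul hg)]
          refine lintegral_congr fun y => ?_
          rw [lintegral_mul_const _ (measurable_one.indicator measurableSet_ball),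
            lintegral_indicator_one measurableSet_ball, hball]
      _ = ∫⁻ z, ∫⁻ y, (Metric.ball y ρ).indicator 1 z * (G y * g y) := by
          refine lintegral_lintegral_swap (Measurable.aemeasurable ?_)
          refine Measurable.mul ?_ ((hGm.mul hg).comp measurable_fst)
          exact measurable_one.indicator hDm
      _ ≤ ∫⁻ z, c * ENNReal.ofReal (gaussKernel (x - z) (2 * t)) * K := by
          refine lintegral_mono fun z => ?_
          calc ∫⁻ y, (Metric.ball y ρ).indicator 1 z * (G y * g y)
              = ∫⁻ y in Metric.ball z ρ, G y * g y := by
                rw [← lintegral_indicator measurableSet_ball]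
                refine lintegral_congr fun y => ?_
                by_cases h : dist z y < ρ
                · rw [Set.indicator_of_mem (by exact h), Set.indicator_of_mem
                    (by rw [Metric.mem_ball, dist_comm]; exact h)]
                  simp
                · rw [Set.indicator_of_notMem (by exact h), Set.indicator_of_notMem
                    (by rw [Metric.mem_ball, dist_comm]; exact h)]
                  simp
            _ ≤ ∫⁻ y in Metric.ball z ρ,
                  (c * ENNReal.ofReal (gaussKernel (x - z) (2 * t))) * g y := by
                refine setLIntegral_mono' measurableSet_ball fun y hy => ?_
                gcongr
                simp only [G, c]
                rw [← ENNReal.ofReal_mul (by positivity)]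
                refine ENNReal.ofReal_le_ofReal (gaussKernel_le ht hρ.le hρt ?_)
                rw [sub_sub_sub_cancel_left, ← dist_eq_norm, dist_comm]
                exact (Metric.mem_ball.1 hy).le
            _ ≤ _ := by
                rw [lintegral_const_mul _ hg]
                gcongr
                exact hK z
      _ = c * K := by
          have hm : Measurable fun z : EuclideanSpace ℝ (Fin N) =>
              ENNReal.ofReal (gaussKernel (x - z) (2 * t)) :=
            (((continuous_gaussKernel (2 * t)).comp
              (continuous_const.sub continuous_id)).measurable).ennreal_ofReal
          rw [lintegral_mul_const _ (hm.const_mul _), lintegral_const_mul _ hm,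
            lintegral_sub_left_eq_self (fun z => ENNReal.ofReal (gaussKernel z (2 * t))) x,
            lintegral_gaussKernel (by positivity), mul_one]
  calc ∫⁻ y, G y * g y = V⁻¹ * (V * ∫⁻ y, G y * g y) := by
        rw [← mul_assoc, ENNReal.inv_mul_cancel hV0 hVt, one_mul]
    _ ≤ V⁻¹ * (c * K) := by gcongr
    _ = _ := by ring

/-- Jensen's inequality for Gaussian averages. -/
theorem lintegral_gaussKernel_mul_rpow_le {N : ℕ} {t : ℝ} (ht : 0 < t) {p : ℝ} (hp : 1 ≤ p)
    {g : EuclideanSpace ℝ (Fin N) → ℝ≥0∞} (hg : Measurable g) (x : EuclideanSpace ℝ (Fin N)) :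
    (∫⁻ y, ENNReal.ofReal (gaussKernel (x - y) t) * g y) ^ p
      ≤ ∫⁻ y, ENNReal.ofReal (gaussKernel (x - y) t) * g y ^ p := by
  have hm : Measurable fun z : EuclideanSpace ℝ (Fin N) => ENNReal.ofReal (gaussKernel (x - z) t) :=
    (((continuous_gaussKernel t).comp (continuous_const.sub continuous_id)).measurable).ennreal_ofReal
  set μ := (volume : Measure (EuclideanSpace ℝ (Fin N))).withDensity
    fun y => ENNReal.ofReal (gaussKernel (x - y) t) with hμ
  have hprob : IsProbabilityMeasure μ := ⟨by
    rw [hμ, withDensity_apply _ MeasurableSet.univ, Measure.restrict_univ,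
      lintegral_sub_left_eq_self (fun z => ENNReal.ofReal (gaussKernel z t)) x,
      lintegral_gaussKernel ht]⟩
  have e1 : ∀ h : EuclideanSpace ℝ (Fin N) → ℝ≥0∞, Measurable h →
      ∫⁻ y, ENNReal.ofReal (gaussKernel (x - y) t) * h y = ∫⁻ y, h y ∂μ := fun h hh => by
    rw [hμ, lintegral_withDensity_eq_lintegral_mul _ hm hh]; rfl
  rw [e1 _ hg, e1 _ (hg.pow_const p)]
  have := eLpNorm'_le_eLpNorm'_of_exponent_le (μ := μ) (f := g) one_pos hp
    hg.aestronglyMeasurable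
  simp only [eLpNorm', enorm_eq_self, ENNReal.rpow_one, div_one, one_div] at this
  exact (ENNReal.le_rpow_inv_iff (by linarith)).1 this

theorem enorm_heatSemigroup_le {N : ℕ} {t : ℝ} (ht : 0 < t) (φ : EuclideanSpace ℝ (Fin N) → ℝ)
    (x : EuclideanSpace ℝ (Fin N)) :
    ‖heatSemigroup t φ x‖ₑ ≤ ∫⁻ y, ENNReal.ofReal (gaussKernel (x - y) t) * ‖φ y‖ₑ := by
  refine (enorm_integral_le_lintegral_enorm _).trans (le_of_eq (lintegral_congr fun y => ?_))
  rw [enorm_mul, Real.enorm_of_nonneg (gaussKernel_nonneg _ ht)]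

theorem enorm_heatSemigroup_rpow_le {N : ℕ} {t : ℝ} (ht : 0 < t) {p : ℝ} (hp : 1 ≤ p)
    {φ : EuclideanSpace ℝ (Fin N) → ℝ} (hφ : Measurable φ) (x : EuclideanSpace ℝ (Fin N)) :
    ‖heatSemigroup t φ x‖ₑ ^ p
      ≤ ∫⁻ y, ENNReal.ofReal (gaussKernel (x - y) t) * ‖φ y‖ₑ ^ p :=
  (ENNReal.rpow_le_rpow (enorm_heatSemigroup_le ht φ x) (by linarith)).trans
    (lintegral_gaussKernel_mul_rpow_le ht hp hφ.enorm x)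

theorem measurable_heatSemigroup {N : ℕ} (t : ℝ) {φ : EuclideanSpace ℝ (Fin N) → ℝ}
    (hφ : Measurable φ) : Measurable (heatSemigroup t φ) := by
  have : StronglyMeasurable (Function.uncurry
      fun x y : EuclideanSpace ℝ (Fin N) => gaussKernel (x - y) t * φ y) := by
    refine Measurable.stronglyMeasurable ?_
    exact ((continuous_gaussKernel t).measurable.comp
      (measurable_fst.sub measurable_snd)).mul (hφ.comp measurable_snd)
  exact this.integral_prod_right.measurable

/-! ### Uniformly local mass bounds -/

/-- Every measurable subset of measure at most `s` of a ball of radius `R` carries `g`-mass at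
most `W s`. -/
def MassBound {N : ℕ} (g : EuclideanSpace ℝ (Fin N) → ℝ≥0∞) (R : ℝ) (W : ℝ → ℝ≥0∞) : Prop :=
  ∀ (x : EuclideanSpace ℝ (Fin N)) (s : ℝ), 0 < s → ∀ E ⊆ Metric.ball x R, MeasurableSet E →
    volume E ≤ ENNReal.ofReal s → ∫⁻ y in E, g y ≤ W s

/-- After Jensen, each shift `w` contributes the mass of `φ` on `E - w`, a set of the same measure
in the ball about `x - w`. This is why a mass bound is required at all centres; averaging over `w`
then loses no constant. -/
theorem massBound_heatSemigroup {N : ℕ} {t : ℝ} (ht : 0 < t) {p : ℝ} (hp : 1 ≤ p)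
    {φ : EuclideanSpace ℝ (Fin N) → ℝ} (hφ : Measurable φ) {R : ℝ} {W : ℝ → ℝ≥0∞}
    (h : MassBound (fun y => ‖φ y‖ₑ ^ p) R W) :
    MassBound (fun y => ‖heatSemigroup t φ y‖ₑ ^ p) R W := by
  intro x s hs E hEx hE hEs
  have hgm : Measurable fun y => ‖φ y‖ₑ ^ p := hφ.enorm.pow_const p
  have hG : Measurable fun z : EuclideanSpace ℝ (Fin N) => ENNReal.ofReal (gaussKernel z t) :=
    (continuous_gaussKernel t).measurable.ennreal_ofReal
  calc ∫⁻ y in E, ‖heatSemigroup t φ y‖ₑ ^ p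
      ≤ ∫⁻ y in E, ∫⁻ z, ENNReal.ofReal (gaussKernel (y - z) t) * ‖φ z‖ₑ ^ p :=
        lintegral_mono fun y => enorm_heatSemigroup_rpow_le ht hp hφ y
    _ = ∫⁻ y in E, ∫⁻ w, ENNReal.ofReal (gaussKernel w t) * ‖φ (y - w)‖ₑ ^ p := by
        refine lintegral_congr fun y => ?_
        rw [← lintegral_sub_left_eq_self _ y]
        simp only [sub_sub_cancel]
    _ = ∫⁻ w, ∫⁻ y in E, ENNReal.ofReal (gaussKernel w t) * ‖φ (y - w)‖ₑ ^ p := by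
        refine lintegral_lintegral_swap (Measurable.aemeasurable ?_)
        exact (hG.comp measurable_snd).mul (hgm.comp (measurable_fst.sub measurable_snd))
    _ ≤ ∫⁻ w, ENNReal.ofReal (gaussKernel w t) * W s := by
        refine lintegral_mono fun w => ?_
        rw [lintegral_const_mul (f := fun y => ‖φ (y - w)‖ₑ ^ p) _
          (hgm.comp (measurable_id.sub_const w))]
        gcongr
        have hmp := measurePreserving_sub_right (volume : Measure (EuclideanSpace ℝ (Fin N))) w
        have hE' : MeasurableSet ((fun y => y + w) ⁻¹' E) := hE.preimage (measurable_add_const w)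
        have hpre : (fun y => y - w) ⁻¹' ((fun y => y + w) ⁻¹' E) = E := by
          ext y; simp
        have hvol : volume ((fun y => y + w) ⁻¹' E) = volume E :=
          (measurePreserving_add_right volume w).measure_preimage hE.nullMeasurableSet
        rw [← hpre, hmp.setLIntegral_comp_preimage hE' hgm]
        refine h (x - w) s hs _ (fun y hy => ?_) hE' (hvol.le.trans hEs)
        have hyw : y + w ∈ Metric.ball x R := hEx hy
        rw [Metric.mem_ball, dist_eq_norm] at hyw ⊢
        rwa [sub_sub_eq_add_sub]
    _ = W s := by
        rw [lintegral_mul_const _ hG, lintegral_gaussKernel ht, one_mul]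

/-- For `l < u*(s)` the level set `{|u| > l}` has measure above `s`; testing on a subset of measure
exactly `s` gives `s l^p ≤ s P(s)^p`. No monotonicity of `P` is needed. -/
theorem MassBound.rearr_le {N : ℕ} (hN : 1 ≤ N) {u : EuclideanSpace ℝ (Fin N) → ℝ}
    (hu : Measurable u) {R p : ℝ} (hp : 0 < p) {P : ℝ → ℝ≥0∞}
    (h : MassBound (fun y => ‖u y‖ₑ ^ p) R fun s => ENNReal.ofReal s * P s ^ p)
    (x : EuclideanSpace ℝ (Fin N)) {s : ℝ} (hs : 0 < s) :
    rearr ((Metric.ball x R).indicator u) s ≤ P s := by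
  refine le_of_forall_lt fun c hc => ?_
  obtain ⟨l, hcl, hl⟩ := ENNReal.lt_iff_exists_nnreal_btwn.1 hc
  refine lt_of_lt_of_le hcl ?_
  rw [← ENNReal.ofReal_coe_nnreal] at hl hcl ⊢
  have hl0 : (0 : ℝ) < l := ENNReal.ofReal_pos.1 (lt_of_le_of_lt zero_le hcl)
  have hD : ENNReal.ofReal s < distribFun ((Metric.ball x R).indicator u) l :=
    not_le.1 fun hD => (hl.trans_le (rearr_le_of_distribFun_le hl0 hD)).false
  have hsub : {y | (l : ℝ) < |(Metric.ball x R).indicator u y|} ⊆ Metric.ball x R := by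
    intro y hy
    by_contra hyB
    rw [Set.mem_ofPred_eq, Set.indicator_of_notMem hyB, abs_zero] at hy
    exact (hl0.trans hy).false
  obtain ⟨E, hEA, hEm, hEs⟩ := exists_measurable_subset_volume_eq hN
    (measurableSet_lt measurable_const (hu.indicator measurableSet_ball).abs) hsub hD.le
  have h1 := h x s hs E (hEA.trans hsub) hEm hEs.le
  have h2 : ENNReal.ofReal s * ENNReal.ofReal l ^ p ≤ ENNReal.ofReal s * P s ^ p := by
    refine le_trans ?_ h1
    rw [← hEs, mul_comm, ← setLIntegral_const]
    refine setLIntegral_mono' hEm fun y hy => ?_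
    have h3 : (l : ℝ) < |(Metric.ball x R).indicator u y| := hEA hy
    rw [Set.indicator_of_mem (hsub (hEA hy))] at h3
    rw [Real.enorm_eq_ofReal_abs]
    exact ENNReal.rpow_le_rpow (ENNReal.ofReal_le_ofReal h3.le) hp.le
  rw [ENNReal.mul_le_mul_iff_right (by simpa using hs) ENNReal.ofReal_ne_top] at h2
  exact (ENNReal.rpow_le_rpow_iff hp).1 h2

/-- Smoothing: a mass bound for `φ` gives a pointwise bound for `S(t)φ`. -/
theorem exists_enorm_heatSemigroup_le {N : ℕ} (hN : 1 ≤ N) : ∃ C : ℝ, 1 ≤ C ∧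
    ∀ (φ : EuclideanSpace ℝ (Fin N) → ℝ), Measurable φ → ∀ (p R t : ℝ) (P : ℝ → ℝ≥0∞), 1 ≤ p →
      0 < R → 0 < t → t < R ^ 2 →
      MassBound (fun y => ‖φ y‖ₑ ^ p) R (fun s => ENNReal.ofReal s * P s ^ p) →
      ∀ x, ‖heatSemigroup t φ x‖ₑ ≤ ENNReal.ofReal C * P (t ^ ((N : ℝ) / 2)) := by
  have : Nonempty (Fin N) := ⟨⟨0, hN⟩⟩
  set ω := (volume (Metric.ball (0 : EuclideanSpace ℝ (Fin N)) 1)).toReal with hω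
  have hω0 : 0 < ω := ENNReal.toReal_pos (Metric.measure_ball_pos _ _ one_pos).ne'
    measure_ball_lt_top.ne
  -- Chosen so that the ball of radius `ε√t` has volume at most `T = t^{N/2}` and radius at most `√t
  -- ≤ R`; the mass bound then applies at `s = T`.
  set ε := min 1 (1 / ω) with hε
  have hε0 : 0 < ε := by positivity
  have hεω : ε ^ N * ω ≤ 1 := by
    calc ε ^ N * ω ≤ ε ^ 1 * ω := by
          gcongr ?_ * _
          exact pow_le_pow_of_le_one hε0.le (min_le_left _ _) hN
      _ ≤ 1 / ω * ω := by gcongr; rw [pow_one]; exact min_le_right _ _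
      _ = 1 := by field_simp
  set c := Real.exp (1 / 4) * 2 ^ ((N : ℝ) / 2) with hc
  -- A constant `C ≥ 1` satisfies `C ≤ C^p`, so taking `p`-th roots is harmless uniformly in `p ≥
  -- 1`.
  refine ⟨max 1 (c * (ε ^ N * ω)⁻¹), le_max_left _ _, ?_⟩
  intro φ hφ p R t P hp hR ht htR h x
  set T := t ^ ((N : ℝ) / 2) with hT
  have hT0 : 0 < T := by positivity
  set ρ := ε * √t with hρ
  have hst : 0 < √t := Real.sqrt_pos.2 ht
  have hρ0 : 0 < ρ := by positivity
  have hρle : ρ ≤ √t := mul_le_of_le_one_left hst.le (min_le_left _ _)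
  have hρt : ρ ^ 2 ≤ t := by
    calc ρ ^ 2 ≤ √t ^ 2 := by gcongr
      _ = t := Real.sq_sqrt ht.le
  have hρR : ρ ≤ R := hρle.trans (by rw [Real.sqrt_le_left hR.le]; exact htR.le)
  have hsT : √t ^ N = T := by
    rw [Real.sqrt_eq_rpow, ← Real.rpow_natCast, ← Real.rpow_mul ht.le, hT]; ring_nf
  have hvol : ∀ z : EuclideanSpace ℝ (Fin N),
      volume (Metric.ball z ρ) = ENNReal.ofReal (ε ^ N * ω * T) := by
    intro z
    have := Measure.addHaar_ball_mul (volume : Measure (EuclideanSpace ℝ (Fin N))) z hρ0.le 1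
    rw [mul_one] at this
    rw [this, finrank_euclideanSpace_fin, ← ENNReal.ofReal_toReal (measure_ball_lt_top
      (μ := (volume : Measure (EuclideanSpace ℝ (Fin N)))) (x := 0) (r := 1)).ne, ← hω,
      ← ENNReal.ofReal_mul (by positivity), hρ, mul_pow, hsT]
    ring_nf
  have hmass : ∀ z, ∫⁻ y in Metric.ball z ρ, ‖φ y‖ₑ ^ p ≤ ENNReal.ofReal T * P T ^ p := fun z =>
    h z T hT0 _ (Metric.ball_subset_ball hρR) measurableSet_ball (by
      rw [hvol]
      exact ENNReal.ofReal_le_ofReal (mul_le_of_le_one_left hT0.le hεω))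
  have h1 := (enorm_heatSemigroup_rpow_le ht hp hφ x).trans
    (lintegral_gaussKernel_mul_le ht hρ0 hρt (hφ.enorm.pow_const p) hmass x)
  rw [hvol, ← ENNReal.ofReal_inv_of_pos (by positivity), ← mul_assoc,
    ← ENNReal.ofReal_mul (by positivity), ← ENNReal.ofReal_mul (by positivity)] at h1
  have h2 : Real.exp (1 / 4) * 2 ^ ((N : ℝ) / 2) * (ε ^ N * ω * T)⁻¹ * T = c * (ε ^ N * ω)⁻¹ := by
    rw [hc]; field_simp
  rw [h2] at h1
  have hp0 : 0 < p := by linarith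
  rw [← ENNReal.rpow_le_rpow_iff hp0, ENNReal.mul_rpow_of_nonneg _ _ hp0.le]
  refine h1.trans ?_
  gcongr
  rw [ENNReal.ofReal_rpow_of_pos (by positivity)]
  refine ENNReal.ofReal_le_ofReal ((le_max_right 1 _).trans ?_)
  exact Real.self_le_rpow_of_one_le (le_max_left _ _) hp

/-- Since the averaging radius is `min R √t`, a finite mass bound at one fixed radius gives absolute
convergence for every `t > 0`. -/
theorem MassBound.heatIntegrable {N : ℕ} {φ : EuclideanSpace ℝ (Fin N) → ℝ} (hφ : Measurable φ)
    {p R t : ℝ} {W : ℝ → ℝ≥0∞} (hp : 1 ≤ p) (hR : 0 < R) (ht : 0 < t)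
    (h : MassBound (fun y => ‖φ y‖ₑ ^ p) R W) (hW : ∀ s, 0 < s → W s ≠ ∞) :
    HeatIntegrable t φ := by
  intro x
  have hp0 : 0 < p := by linarith
  set ρ := min R √t with hρ
  have hst : 0 < √t := Real.sqrt_pos.2 ht
  have hρ0 : 0 < ρ := lt_min hR hst
  have hρt : ρ ^ 2 ≤ t := by
    calc ρ ^ 2 ≤ √t ^ 2 := by gcongr; exact min_le_right _ _
      _ = t := Real.sq_sqrt ht.le
  set V := volume (Metric.ball (0 : EuclideanSpace ℝ (Fin N)) ρ) with hV
  have hV0 : V ≠ 0 := (Metric.measure_ball_pos _ _ hρ0).ne'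
  have hVt : V ≠ ∞ := measure_ball_lt_top.ne
  have hmass : ∀ z, ∫⁻ y in Metric.ball z ρ, ‖φ y‖ₑ ^ p ≤ W V.toReal := fun z =>
    h z _ (ENNReal.toReal_pos hV0 hVt) _ (Metric.ball_subset_ball (min_le_left _ _))
      measurableSet_ball (by rw [ENNReal.ofReal_toReal hVt, hV, Measure.addHaar_ball_center])
  have h1 := (lintegral_gaussKernel_mul_rpow_le ht hp hφ.enorm x).trans
    (lintegral_gaussKernel_mul_le ht hρ0 hρt (hφ.enorm.pow_const p) hmass x)
  refine ⟨((continuous_gaussKernel t).measurable.comp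
    (measurable_const.sub measurable_id)).mul hφ |>.aestronglyMeasurable, ?_⟩
  have h2 : (∫⁻ y, ENNReal.ofReal (gaussKernel (x - y) t) * ‖φ y‖ₑ) ^ p < ∞ :=
    h1.trans_lt (ENNReal.mul_lt_top (ENNReal.mul_lt_top ENNReal.ofReal_lt_top
      (ENNReal.inv_lt_top.2 (pos_iff_ne_zero.2 hV0)))
      (lt_top_iff_ne_top.2 (hW _ (ENNReal.toReal_pos hV0 hVt))))
  rw [ENNReal.rpow_lt_top_iff_of_pos hp0] at h2
  refine lt_of_eq_of_lt (lintegral_congr fun y => ?_) h2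
  rw [enorm_mul, Real.enorm_of_nonneg (gaussKernel_nonneg _ ht)]


/-! ### Zygmund weights -/

namespace IsZygmundWeight

variable {Φ : ℝ → ℝ}

theorem one_le (hΦ : IsZygmundWeight Φ) {a : ℝ} (ha : 0 ≤ a) : 1 ≤ Φ a := by
  rw [← hΦ.map_zero]
  exact hΦ.monotoneOn Set.self_mem_Ici ha ha

theorem pos (hΦ : IsZygmundWeight Φ) {a : ℝ} (ha : 0 ≤ a) : 0 < Φ a :=
  zero_lt_one.trans_le (hΦ.one_le ha)

theorem inv_le_inv (hΦ : IsZygmundWeight Φ) {a b : ℝ} (ha : 0 < a) (hab : a ≤ b) :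
    Φ b⁻¹ ≤ Φ a⁻¹ :=
  hΦ.monotoneOn (inv_pos.2 (ha.trans_le hab)).le (inv_pos.2 ha).le (inv_anti₀ ha hab)

theorem exists_pow_le (hΦ : IsZygmundWeight Φ) (k : ℕ) :
    ∃ C : ℝ, 0 < C ∧ ∀ a : ℝ, 0 ≤ a → Φ (a ^ (2 ^ k)) ≤ C * Φ a := by
  obtain ⟨C, hC, h⟩ := hΦ.sq_le
  refine ⟨C ^ k, by positivity, ?_⟩
  induction k with
  | zero => intro a _; simp
  | succ k ih =>
    intro a ha
    rw [pow_succ, pow_mul]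
    refine (h _ (by positivity)).trans ?_
    rw [pow_succ', mul_assoc]
    gcongr
    exact ih a ha

/-- `Φ (a ^ κ)` is controlled by `Φ a`, for every power `κ > 0`. -/
theorem exists_rpow_le (hΦ : IsZygmundWeight Φ) {κ : ℝ} (hκ : 0 < κ) :
    ∃ C : ℝ, 0 < C ∧ ∀ a : ℝ, 0 ≤ a → Φ (a ^ κ) ≤ C * Φ a := by
  obtain ⟨k, hk⟩ := pow_unbounded_of_one_lt κ (one_lt_two (α := ℝ))
  obtain ⟨C, hC, h⟩ := hΦ.exists_pow_le k
  refine ⟨C + Φ 1, add_pos hC (hΦ.pos zero_le_one), fun a ha => ?_⟩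
  have hΦa := hΦ.one_le ha
  have hΦ1 := hΦ.one_le zero_le_one
  rcases le_total a 1 with h1 | h1
  · have : Φ (a ^ κ) ≤ Φ 1 := hΦ.monotoneOn (Real.rpow_nonneg ha _) (zero_le_one' ℝ)
      (Real.rpow_le_one ha h1 hκ.le)
    nlinarith
  · have : Φ (a ^ κ) ≤ Φ (a ^ (2 ^ k)) := by
      refine hΦ.monotoneOn (Real.rpow_nonneg ha _) (pow_nonneg ha _) ?_
      rw [← Real.rpow_natCast]
      refine Real.rpow_le_rpow_of_exponent_le h1 ?_
      push_cast
      exact hk.le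
    nlinarith [h a ha]

/-- Extends the hypothesis from `[τ₀, ∞)` to `(0, ∞)`: below `τ₀` the weight lies between `1` and `Φ
τ₀`, which costs only a factor `Φ τ₀`. -/
theorem exists_almost_decreasing (hΦ : IsZygmundWeight Φ) {δ : ℝ} (hδ : 0 < δ) :
    ∃ C : ℝ, 0 < C ∧ ∀ a b : ℝ, 0 < a → a ≤ b → b ^ (-δ) * Φ b ≤ C * (a ^ (-δ) * Φ a) := by
  obtain ⟨C, τ₀, hC, hτ₀, h⟩ := hΦ.almost_decreasing δ hδ
  have hP : 1 ≤ Φ τ₀ := hΦ.one_le hτ₀.le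
  refine ⟨(C + 1) * Φ τ₀, by positivity, fun a b ha hab => ?_⟩
  have hb : 0 < b := ha.trans_le hab
  have hΦa := hΦ.one_le ha.le
  have hanti : ∀ x y : ℝ, 0 < x → x ≤ y → y ^ (-δ) ≤ x ^ (-δ) := fun x y hx hxy =>
    Real.rpow_le_rpow_of_nonpos hx hxy (by linarith)
  have hapos : 0 < a ^ (-δ) := Real.rpow_pos_of_pos ha _
  rcases le_total τ₀ a with h1 | h1
  · refine (h a b h1 hab).trans ?_
    have : 0 < a ^ (-δ) * Φ a := by positivity
    gcongr
    nlinarith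
  rcases le_total τ₀ b with h2 | h2
  · calc b ^ (-δ) * Φ b ≤ C * (τ₀ ^ (-δ) * Φ τ₀) := h _ _ le_rfl h2
      _ ≤ C * (a ^ (-δ) * Φ τ₀) := by gcongr ?_ * (?_ * _); exact hanti _ _ ha h1
      _ ≤ (C + 1) * (a ^ (-δ) * Φ τ₀) * Φ a := by
          have : 0 < a ^ (-δ) * Φ τ₀ := by positivity
          nlinarith [mul_pos hC this]
      _ = _ := by ring
  · calc b ^ (-δ) * Φ b ≤ a ^ (-δ) * Φ τ₀ := by
          exact mul_le_mul (hanti _ _ ha hab) (hΦ.monotoneOn hb.le hτ₀.le h2)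
            (hΦ.pos hb.le).le hapos.le
      _ ≤ (C + 1) * (a ^ (-δ) * Φ τ₀) * Φ a := by
          have : 0 < a ^ (-δ) * Φ τ₀ := by positivity
          nlinarith [mul_pos hC this]
      _ = _ := by ring

/-- `s ↦ s ^ δ Φ(s⁻¹) ^ γ` is almost increasing on `(0, ∞)`. -/
theorem exists_almost_increasing (hΦ : IsZygmundWeight Φ) {δ γ : ℝ} (hδ : 0 < δ) (hγ : 0 ≤ γ) :
    ∃ C : ℝ, 0 < C ∧ ∀ T τ : ℝ, 0 < T → T ≤ τ →
      T ^ δ * Φ T⁻¹ ^ γ ≤ C * (τ ^ δ * Φ τ⁻¹ ^ γ) := by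
  rcases hγ.eq_or_lt with rfl | hγ
  · refine ⟨1, one_pos, fun T τ hT hTτ => ?_⟩
    simp only [Real.rpow_zero, mul_one, one_mul]
    gcongr
  -- The previous property with exponent `δ / γ`, taken at the reciprocals `τ⁻¹ ≤ T⁻¹` and raised to
  -- the power `γ`.
  · obtain ⟨C, hC, h⟩ := hΦ.exists_almost_decreasing (div_pos hδ hγ)
    refine ⟨C ^ γ, by positivity, fun T τ hT hTτ => ?_⟩
    have hτ : 0 < τ := hT.trans_le hTτ
    have e : ∀ x : ℝ, 0 < x → (x⁻¹ ^ (-(δ / γ)) * Φ x⁻¹) ^ γ = x ^ δ * Φ x⁻¹ ^ γ := by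
      intro x hx
      rw [Real.mul_rpow (by positivity) (hΦ.pos (by positivity)).le, Real.inv_rpow hx.le,
        ← Real.rpow_neg hx.le, neg_neg, ← Real.rpow_mul hx.le, div_mul_cancel₀ _ hγ.ne']
    have h1 := h τ⁻¹ T⁻¹ (by positivity) (inv_anti₀ hT hTτ)
    have hpos : ∀ x : ℝ, 0 < x → 0 < x⁻¹ ^ (-(δ / γ)) * Φ x⁻¹ := fun x hx =>
      mul_pos (by positivity) (hΦ.pos (by positivity))
    have h2 := Real.rpow_le_rpow (hpos T hT).le h1 hγ.le
    rwa [Real.mul_rpow hC.le (hpos τ hτ).le, e _ hT, e _ hτ] at h2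

end IsZygmundWeight

/-! ### Profiles -/

/-- The extremal profile `s^{-q} Φ(s⁻¹)^{-αq}` of the weak Zygmund space with `q = 1/r`. -/
noncomputable def zygmundProfile (Φ : ℝ → ℝ) (q α s : ℝ) : ℝ := s ^ (-q) * Φ s⁻¹ ^ (-(α * q))

/-- The decay rate expressed through the volume scale `T = t^{N/2}`. -/
noncomputable def volumeRate (Φ : ℝ → ℝ) (q₁ q₂ α β T : ℝ) : ℝ :=
  T ^ (-(q₁ - q₂)) * Φ T⁻¹ ^ (-(α * q₁) + β * q₂)

namespace IsZygmundWeight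

variable {Φ : ℝ → ℝ}

theorem zygmundProfile_pos (hΦ : IsZygmundWeight Φ) (q α : ℝ) {s : ℝ} (hs : 0 < s) :
    0 < zygmundProfile Φ q α s :=
  mul_pos (Real.rpow_pos_of_pos hs _) (Real.rpow_pos_of_pos (hΦ.pos (inv_pos.2 hs).le) _)

theorem volumeRate_pos (hΦ : IsZygmundWeight Φ) (q₁ q₂ α β : ℝ) {s : ℝ} (hs : 0 < s) :
    0 < volumeRate Φ q₁ q₂ α β s :=
  mul_pos (Real.rpow_pos_of_pos hs _) (Real.rpow_pos_of_pos (hΦ.pos (inv_pos.2 hs).le) _)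

theorem zygmundProfile_rpow (hΦ : IsZygmundWeight Φ) (q α r : ℝ) {s : ℝ} (hs : 0 < s) :
    zygmundProfile Φ q α s ^ r = s ^ (-(q * r)) * Φ s⁻¹ ^ (-(α * (q * r))) := by
  have hP := hΦ.pos (inv_pos.2 hs).le
  rw [zygmundProfile, Real.mul_rpow (by positivity) (by positivity), ← Real.rpow_mul hs.le,
    ← Real.rpow_mul hP.le]
  ring_nf

theorem volumeRate_rpow (hΦ : IsZygmundWeight Φ) (q₁ q₂ α β r : ℝ) {s : ℝ} (hs : 0 < s) :
    volumeRate Φ q₁ q₂ α β s ^ r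
      = s ^ (-(q₁ * r - q₂ * r)) * Φ s⁻¹ ^ (-(α * (q₁ * r)) + β * (q₂ * r)) := by
  have hP := hΦ.pos (inv_pos.2 hs).le
  rw [volumeRate, Real.mul_rpow (by positivity) (by positivity), ← Real.rpow_mul hs.le,
    ← Real.rpow_mul hP.le]
  ring_nf

/-- The exponent `e` of the weight has no fixed sign. For `e ≥ 0` the power `N/2` is compared
directly; for `e ≤ 0` the reverse comparison comes from the power `2/N` applied at `t^{-N/2}`. -/
theorem exists_volumeRate_le (hΦ : IsZygmundWeight Φ) {N : ℕ} (hN : 1 ≤ N) (r₁ r₂ : ℝ≥0∞)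
    (α β : ℝ) : ∃ C : ℝ, 0 < C ∧ ∀ t : ℝ, 0 < t →
      volumeRate Φ r₁⁻¹.toReal r₂⁻¹.toReal α β (t ^ ((N : ℝ) / 2))
        ≤ C * decayRate N Φ r₁ r₂ α β t := by
  have hN0 : (0 : ℝ) < N := by exact_mod_cast hN
  set e := -(α * r₁⁻¹.toReal) + β * r₂⁻¹.toReal with he
  have key : ∃ C : ℝ, 0 < C ∧ ∀ t : ℝ, 0 < t →
      Φ (t ^ ((N : ℝ) / 2))⁻¹ ^ e ≤ C * Φ t⁻¹ ^ e := by
    rcases le_total 0 e with h0 | h0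
    · obtain ⟨C, hC, h⟩ := hΦ.exists_rpow_le (half_pos hN0)
      refine ⟨C ^ e, by positivity, fun t ht => ?_⟩
      rw [← Real.mul_rpow hC.le (hΦ.pos (by positivity)).le, ← Real.inv_rpow ht.le]
      exact Real.rpow_le_rpow (hΦ.pos (by positivity)).le (h _ (by positivity)) h0
    · obtain ⟨C, hC, h⟩ := hΦ.exists_rpow_le (div_pos two_pos hN0)
      refine ⟨C⁻¹ ^ e, by positivity, fun t ht => ?_⟩
      have hP := hΦ.pos (inv_pos.2 ht).le
      have h1 := h (t ^ ((N : ℝ) / 2))⁻¹ (by positivity)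
      rw [Real.inv_rpow (by positivity), ← Real.rpow_mul ht.le,
        show (N : ℝ) / 2 * (2 / N) = 1 by field_simp, Real.rpow_one] at h1
      rw [← Real.mul_rpow (by positivity) hP.le]
      refine Real.rpow_le_rpow_of_nonpos (by positivity) ?_ h0
      rwa [inv_mul_le_iff₀ hC]
  obtain ⟨C, hC, h⟩ := key
  refine ⟨C, hC, fun t ht => ?_⟩
  rw [volumeRate, decayRate, ← Real.rpow_mul ht.le]
  calc _ ≤ t ^ ((N : ℝ) / 2 * -(r₁⁻¹.toReal - r₂⁻¹.toReal)) * (C * Φ t⁻¹ ^ e) := by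
        gcongr
        exact h t ht
    _ = _ := by
        rw [show (N : ℝ) / 2 * -(r₁⁻¹.toReal - r₂⁻¹.toReal)
          = -((N : ℝ) / 2) * (r₁⁻¹.toReal - r₂⁻¹.toReal) by ring]
        ring

/-- The integral estimate behind the gain of integrability. -/
theorem exists_lintegral_le (hΦ : IsZygmundWeight Φ) {m γ β : ℝ} (hm : 1 < m) (hγ : 0 ≤ γ)
    (hβ : 0 ≤ β) : ∃ C : ℝ, 0 < C ∧ ∀ (T s : ℝ) (K : ℝ≥0∞) (F : ℝ → ℝ≥0∞), 0 < T → 0 < s →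
      K ≠ ∞ → (∀ τ, 0 < τ → F τ ≤ K * ENNReal.ofReal (τ ^ (-m) * Φ τ⁻¹ ^ (-γ))) →
      (∀ τ, 0 < τ → F τ ≤ K * ENNReal.ofReal (T ^ (-m) * Φ T⁻¹ ^ (-γ))) →
      ENNReal.ofReal (Φ s⁻¹ ^ β) * ∫⁻ τ in Set.Ioo 0 s, F τ
        ≤ K * ENNReal.ofReal (C * (T ^ (-(m - 1)) * Φ T⁻¹ ^ (-γ + β))) := by
  obtain ⟨C₁, hC₁, h₁⟩ := hΦ.exists_almost_increasing one_pos hβ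
  -- With `m = 1 + 2δ`, one `τ^{-δ}` makes the weight `Φ(τ⁻¹)^{-γ}` almost decreasing, and the
  -- remaining `τ^{-1-δ}` is integrable at infinity.
  set δ := (m - 1) / 2 with hδ
  have hδ0 : 0 < δ := by rw [hδ]; linarith
  obtain ⟨C₂, hC₂, h₂⟩ := hΦ.exists_almost_increasing hδ0 hγ
  refine ⟨C₁ + 1 + C₂ / δ, by positivity, fun T s K F hT hs hK hF hFT => ?_⟩
  have hPT := hΦ.pos (inv_pos.2 hT).le
  have hPs := hΦ.pos (inv_pos.2 hs).le
  set X := T ^ (-(m - 1)) * Φ T⁻¹ ^ (-γ + β) with hX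
  have hX0 : 0 < X := by positivity
  have hT1 : T * T ^ (-m) = T ^ (-(m - 1)) := by
    nth_rewrite 1 [← Real.rpow_one T]
    rw [← Real.rpow_add hT]; ring_nf
  have hXe : X = T * (T ^ (-m) * Φ T⁻¹ ^ (-γ)) * Φ T⁻¹ ^ β := by
    rw [hX, Real.rpow_add hPT, ← hT1]; ring
  have hsmall : ∀ a : ℝ, 0 < a → ∫⁻ τ in Set.Ioc 0 a, F τ
      ≤ K * ENNReal.ofReal (a * (T ^ (-m) * Φ T⁻¹ ^ (-γ))) := by
    intro a ha
    calc ∫⁻ τ in Set.Ioc 0 a, F τ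
        ≤ ∫⁻ τ in Set.Ioc 0 a, K * ENNReal.ofReal (T ^ (-m) * Φ T⁻¹ ^ (-γ)) :=
          setLIntegral_mono' measurableSet_Ioc fun τ hτ => hFT τ hτ.1
      _ = _ := by
          rw [setLIntegral_const, Real.volume_Ioc, sub_zero, ENNReal.ofReal_mul ha.le]
          ring
  -- For `s ≤ T` the constant bound suffices, as `s Φ(s⁻¹)^β` is almost increasing. For `s ≥ T` the
  -- outer weight is at most `Φ(T⁻¹)^β`, and the integral over all of `(0, ∞)` is split at `T`.
  rcases le_total s T with hsT | hsT
  · calc ENNReal.ofReal (Φ s⁻¹ ^ β) * ∫⁻ τ in Set.Ioo 0 s, F τ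
        ≤ ENNReal.ofReal (Φ s⁻¹ ^ β) * (K * ENNReal.ofReal (s * (T ^ (-m) * Φ T⁻¹ ^ (-γ)))) := by
          gcongr
          exact (lintegral_mono_set Set.Ioo_subset_Ioc_self).trans (hsmall s hs)
      _ = K * ENNReal.ofReal (s ^ (1 : ℝ) * Φ s⁻¹ ^ β * (T ^ (-m) * Φ T⁻¹ ^ (-γ))) := by
          rw [mul_left_comm, ← ENNReal.ofReal_mul (by positivity), Real.rpow_one]
          ring_nf
      _ ≤ K * ENNReal.ofReal (C₁ * (T ^ (1 : ℝ) * Φ T⁻¹ ^ β) * (T ^ (-m) * Φ T⁻¹ ^ (-γ))) := by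
          refine mul_le_mul' le_rfl (ENNReal.ofReal_le_ofReal ?_)
          exact mul_le_mul_of_nonneg_right (h₁ s T hs hsT) (by positivity)
      _ ≤ _ := by
          refine mul_le_mul' le_rfl (ENNReal.ofReal_le_ofReal ?_)
          have : C₁ * (T ^ (1 : ℝ) * Φ T⁻¹ ^ β) * (T ^ (-m) * Φ T⁻¹ ^ (-γ)) = C₁ * X := by
            rw [hXe, Real.rpow_one]; ring
          rw [this]
          have : 0 < C₂ / δ * X := by positivity
          nlinarith
  · have hlarge : ∫⁻ τ in Set.Ioi T, F τ
        ≤ K * ENNReal.ofReal (C₂ / δ * (T ^ (-(m - 1)) * Φ T⁻¹ ^ (-γ))) := by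
      set c := C₂ * T ^ (-δ) * Φ T⁻¹ ^ (-γ) with hc
      have hc0 : 0 < c := by positivity
      have hint : IntegrableOn (fun τ : ℝ => c * τ ^ (-(1 + δ))) (Set.Ioi T) :=
        (integrableOn_Ioi_rpow_of_lt (by linarith) hT).const_mul c
      calc ∫⁻ τ in Set.Ioi T, F τ
          ≤ ∫⁻ τ in Set.Ioi T, K * ENNReal.ofReal (c * τ ^ (-(1 + δ))) := by
            refine setLIntegral_mono' measurableSet_Ioi fun τ hτ => ?_
            have hτT : T < τ := hτ
            have hτ0 : 0 < τ := hT.trans hτT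
            have hPτ := hΦ.pos (inv_pos.2 hτ0).le
            refine (hF τ hτ0).trans ?_
            refine mul_le_mul' le_rfl (ENNReal.ofReal_le_ofReal ?_)
            have h3 := h₂ T τ hT hτT.le
            have e1 : τ ^ (-m) = τ ^ (-(1 + δ)) * τ ^ (-δ) := by
              rw [← Real.rpow_add hτ0]; congr 1; rw [hδ]; ring
            have e2 : τ ^ (-δ) * Φ τ⁻¹ ^ (-γ) ≤ C₂ * T ^ (-δ) * Φ T⁻¹ ^ (-γ) := by
              rw [Real.rpow_neg hτ0.le, Real.rpow_neg hPτ.le, Real.rpow_neg hT.le,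
                Real.rpow_neg hPT.le, ← mul_inv, mul_assoc, ← mul_inv,
                ← div_eq_mul_inv, inv_eq_one_div, div_le_div_iff₀ (by positivity) (by positivity),
                one_mul]
              exact h3
            rw [e1, mul_assoc, mul_comm c]
            gcongr
        _ = K * ENNReal.ofReal (∫ τ in Set.Ioi T, c * τ ^ (-(1 + δ))) := by
            rw [lintegral_const_mul' _ _ hK, ofReal_integral_eq_lintegral_ofReal hint]
            refine (ae_restrict_iff' measurableSet_Ioi).2 (Filter.Eventually.of_forall fun τ hτ => ?_)
            have hτ0 : 0 < τ := hT.trans hτ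
            simp only [Pi.zero_apply]
            positivity
        _ = _ := by
            congr 2
            rw [integral_const_mul, integral_Ioi_rpow_of_lt (by linarith) hT, hc,
              show -(1 + δ) + 1 = -δ by ring, neg_div_neg_eq,
              show -(m - 1) = -δ + -δ by rw [hδ]; ring, Real.rpow_add hT]
            ring
    calc ENNReal.ofReal (Φ s⁻¹ ^ β) * ∫⁻ τ in Set.Ioo 0 s, F τ
        ≤ ENNReal.ofReal (Φ T⁻¹ ^ β) * (K * ENNReal.ofReal (T * (T ^ (-m) * Φ T⁻¹ ^ (-γ)))
          + K * ENNReal.ofReal (C₂ / δ * (T ^ (-(m - 1)) * Φ T⁻¹ ^ (-γ)))) := by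
          refine mul_le_mul' (ENNReal.ofReal_le_ofReal
            (Real.rpow_le_rpow hPs.le (hΦ.inv_le_inv hT hsT) hβ)) ?_
          refine le_trans (lintegral_mono_set (t := Set.Ioc 0 T ∪ Set.Ioi T) ?_) ?_
          · rw [Set.Ioc_union_Ioi_eq_Ioi hT.le]; exact Set.Ioo_subset_Ioi_self
          · exact (lintegral_union_le _ _ _).trans (add_le_add (hsmall T hT) hlarge)
      _ = K * ENNReal.ofReal ((1 + C₂ / δ) * X) := by
          rw [← mul_add, ← ENNReal.ofReal_add (by positivity) (by positivity), mul_left_comm,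
            ← ENNReal.ofReal_mul (by positivity)]
          congr 2
          rw [hX, Real.rpow_add hPT, ← hT1]
          ring
      _ ≤ _ := by
          gcongr
          linarith

/-- The estimate behind the case of equal integrability exponents. -/
theorem exists_mul_le (hΦ : IsZygmundWeight Φ) {α β : ℝ} (hα : 0 ≤ α) (hαβ : α ≤ β) :
    ∃ C : ℝ, 0 < C ∧ ∀ (T s Y : ℝ), 0 < T → 0 < s →
      Y ≤ s ^ (-1 : ℝ) * Φ s⁻¹ ^ (-α) → Y ≤ T ^ (-1 : ℝ) * Φ T⁻¹ ^ (-α) →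
      s * Φ s⁻¹ ^ β * Y ≤ C * Φ T⁻¹ ^ (-α + β) := by
  obtain ⟨C, hC, h⟩ := hΦ.exists_almost_increasing one_pos (hα.trans hαβ)
  refine ⟨C + 1, by positivity, fun T s Y hT hs hYs hYT => ?_⟩
  have hPT := hΦ.pos (inv_pos.2 hT).le
  have hPs := hΦ.pos (inv_pos.2 hs).le
  have hX0 : 0 < Φ T⁻¹ ^ (-α + β) := by positivity
  rcases le_total s T with hsT | hsT
  · have h1 := h s T hs hsT
    simp only [Real.rpow_one] at h1
    calc s * Φ s⁻¹ ^ β * Y ≤ C * (T * Φ T⁻¹ ^ β) * (T ^ (-1 : ℝ) * Φ T⁻¹ ^ (-α)) := by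
          refine (mul_le_mul_of_nonneg_left hYT (by positivity)).trans ?_
          gcongr
      _ = C * Φ T⁻¹ ^ (-α + β) := by
          rw [Real.rpow_neg_one, Real.rpow_add hPT]
          field_simp
      _ ≤ _ := by linarith
  -- Here `α ≤ β` makes the exponent `β - α` nonnegative, so `Φ(s⁻¹) ≤ Φ(T⁻¹)` survives the power.
  · calc s * Φ s⁻¹ ^ β * Y ≤ s * Φ s⁻¹ ^ β * (s ^ (-1 : ℝ) * Φ s⁻¹ ^ (-α)) := by gcongr
      _ = Φ s⁻¹ ^ (-α + β) := by
          rw [Real.rpow_neg_one, Real.rpow_add hPs]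
          field_simp
      _ ≤ Φ T⁻¹ ^ (-α + β) :=
          Real.rpow_le_rpow hPs.le (hΦ.inv_le_inv hT hsT) (by linarith)
      _ ≤ _ := by nlinarith

end IsZygmundWeight


/-! ### Norms and rearrangements -/

theorem enorm_abs_indicator_rpow {N : ℕ} (B : Set (EuclideanSpace ℝ (Fin N)))
    (f : EuclideanSpace ℝ (Fin N) → ℝ) {p : ℝ} (hp : 0 ≤ p) {y : EuclideanSpace ℝ (Fin N)}
    (hy : y ∈ B) :
    ‖|B.indicator f y| ^ p‖ₑ = ‖f y‖ₑ ^ p := by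
  rw [Set.indicator_of_mem hy, Real.enorm_rpow_of_nonneg (abs_nonneg _) hp,
    Real.enorm_abs]

theorem rearrAvg_le {N : ℕ} {f : EuclideanSpace ℝ (Fin N) → ℝ} {s : ℝ} (hs : 0 < s) {M : ℝ≥0∞}
    (h : ∫⁻ τ in Set.Ioo 0 s, rearr f τ ≤ ENNReal.ofReal s * M) : rearrAvg f s ≤ M := by
  have hs0 : ENNReal.ofReal s ≠ 0 := by simpa using hs
  calc rearrAvg f s ≤ (ENNReal.ofReal s)⁻¹ * (ENNReal.ofReal s * M) := by
        rw [rearrAvg]; gcongr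
    _ = M := by rw [← mul_assoc, ENNReal.inv_mul_cancel hs0 ENNReal.ofReal_ne_top, one_mul]

theorem mul_rearrAvg {N : ℕ} {f : EuclideanSpace ℝ (Fin N) → ℝ} {s : ℝ} (hs : 0 < s) {w : ℝ} :
    ENNReal.ofReal (s * w) * rearrAvg f s
      = ENNReal.ofReal w * ∫⁻ τ in Set.Ioo 0 s, rearr f τ := by
  have hs0 : ENNReal.ofReal s ≠ 0 := by simpa using hs
  rw [rearrAvg, ENNReal.ofReal_mul hs.le, mul_comm (ENNReal.ofReal s), mul_assoc,
    ← mul_assoc (ENNReal.ofReal s), ENNReal.mul_inv_cancel hs0 ENNReal.ofReal_ne_top, one_mul]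

theorem weakZygmundNorm_le {N : ℕ} {Φ : ℝ → ℝ} {r : ℝ≥0∞} (hr0 : r ≠ 0) (hr : r ≠ ∞) {α : ℝ}
    {f : EuclideanSpace ℝ (Fin N) → ℝ} {X : ℝ≥0∞}
    (h : ∀ s, 0 < s → ENNReal.ofReal (s * Φ s⁻¹ ^ α) * rearr f s ^ r.toReal ≤ X ^ r.toReal) :
    weakZygmundNorm Φ r α f ≤ X := by
  rw [weakZygmundNorm, if_neg hr]
  refine iSup₂_le fun s hs => ?_
  rw [one_div, ENNReal.rpow_inv_le_iff (ENNReal.toReal_pos hr0 hr)]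
  exact h s hs

theorem avgZygmundNorm_le {N : ℕ} {Φ : ℝ → ℝ} {r : ℝ≥0∞} (hr0 : r ≠ 0) (hr : r ≠ ∞) {α : ℝ}
    {f : EuclideanSpace ℝ (Fin N) → ℝ} {X : ℝ≥0∞}
    (h : ∀ s, 0 < s → ENNReal.ofReal (s * Φ s⁻¹ ^ α)
      * rearrAvg (fun x => |f x| ^ r.toReal) s ≤ X ^ r.toReal) :
    avgZygmundNorm Φ r α f ≤ X := by
  rw [avgZygmundNorm, if_neg hr]
  refine iSup₂_le fun s hs => ?_
  rw [one_div, ENNReal.rpow_inv_le_iff (ENNReal.toReal_pos hr0 hr)]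
  exact h s hs

theorem le_weakZygmundNorm {N : ℕ} {Φ : ℝ → ℝ} {r : ℝ≥0∞} (hr0 : r ≠ 0) (hr : r ≠ ∞) {α : ℝ}
    {f : EuclideanSpace ℝ (Fin N) → ℝ} {s : ℝ} (hs : 0 < s) :
    ENNReal.ofReal (s * Φ s⁻¹ ^ α) * rearr f s ^ r.toReal
      ≤ weakZygmundNorm Φ r α f ^ r.toReal := by
  rw [weakZygmundNorm, if_neg hr, ← ENNReal.rpow_inv_le_iff (ENNReal.toReal_pos hr0 hr)]
  simp only [one_div]
  exact le_iSup₂_of_le s hs le_rfl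

theorem le_avgZygmundNorm {N : ℕ} {Φ : ℝ → ℝ} {r : ℝ≥0∞} (hr0 : r ≠ 0) (hr : r ≠ ∞) {α : ℝ}
    {f : EuclideanSpace ℝ (Fin N) → ℝ} {s : ℝ} (hs : 0 < s) :
    ENNReal.ofReal (s * Φ s⁻¹ ^ α) * rearrAvg (fun x => |f x| ^ r.toReal) s
      ≤ avgZygmundNorm Φ r α f ^ r.toReal := by
  rw [avgZygmundNorm, if_neg hr, ← ENNReal.rpow_inv_le_iff (ENNReal.toReal_pos hr0 hr)]
  simp only [one_div]
  exact le_iSup₂_of_le s hs le_rfl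

theorem weakZygmundNorm_le_avgZygmundNorm {N : ℕ} (Φ : ℝ → ℝ) {r : ℝ≥0∞} (hr0 : r ≠ 0) (α : ℝ)
    (f : EuclideanSpace ℝ (Fin N) → ℝ) : weakZygmundNorm Φ r α f ≤ avgZygmundNorm Φ r α f := by
  by_cases hr : r = ∞
  · simp [weakZygmundNorm, avgZygmundNorm, hr]
  · refine weakZygmundNorm_le hr0 hr fun s hs => le_trans ?_ (le_avgZygmundNorm hr0 hr hs)
    rw [← rearr_abs_rpow _ (ENNReal.toReal_pos hr0 hr)]
    gcongr
    exact rearr_le_rearrAvg _ hs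

theorem ulWeakZygmundNorm_le_ulAvgZygmundNorm {N : ℕ} (Φ : ℝ → ℝ) {r : ℝ≥0∞} (hr0 : r ≠ 0)
    (α R : ℝ) (f : EuclideanSpace ℝ (Fin N) → ℝ) :
    ulWeakZygmundNorm Φ r α R f ≤ ulAvgZygmundNorm Φ r α R f :=
  iSup_mono fun _ => weakZygmundNorm_le_avgZygmundNorm Φ hr0 α _

theorem ulAvgZygmundNorm_top {N : ℕ} (Φ : ℝ → ℝ) (α R : ℝ)
    (f : EuclideanSpace ℝ (Fin N) → ℝ) :
    ulAvgZygmundNorm Φ ∞ α R f = ulWeakZygmundNorm Φ ∞ α R f := by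
  simp [ulAvgZygmundNorm, ulWeakZygmundNorm, avgZygmundNorm, weakZygmundNorm]

theorem toReal_inv_mul_toReal {r : ℝ≥0∞} (hr0 : r ≠ 0) (hr : r ≠ ∞) :
    r⁻¹.toReal * r.toReal = 1 := by
  rw [ENNReal.toReal_inv, inv_mul_cancel₀ (ENNReal.toReal_pos hr0 hr).ne']

/-! ### From norms to mass bounds -/

theorem MassBound.congr_ae {N : ℕ} {g h : EuclideanSpace ℝ (Fin N) → ℝ≥0∞} (hgh : g =ᵐ[volume] h)
    {R : ℝ} {W : ℝ → ℝ≥0∞} (hg : MassBound g R W) : MassBound h R W :=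
  fun x s hs E hE hEm hEs =>
    (lintegral_congr_ae (ae_restrict_of_ae hgh)).symm.trans_le (hg x s hs E hE hEm hEs)

/-- Hardy–Littlewood for `|φ χ_B|^r`: the right-hand side is exactly `A^r Φ(s⁻¹)^{-α}`, the bound
that the norm puts on the integral of the rearrangement over `(0, s)`. -/
theorem massBound_ulAvgZygmundNorm {N : ℕ} {Φ : ℝ → ℝ} (hΦ : IsZygmundWeight Φ) {r : ℝ≥0∞}
    (hr0 : r ≠ 0) (hr : r ≠ ∞) (α R : ℝ) {φ : EuclideanSpace ℝ (Fin N) → ℝ}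
    (hφ : AEMeasurable φ) :
    MassBound (fun y => ‖φ y‖ₑ ^ r.toReal) R fun s => ENNReal.ofReal s *
      (ulAvgZygmundNorm Φ r α R φ * ENNReal.ofReal (zygmundProfile Φ r⁻¹.toReal α s))
        ^ r.toReal := by
  intro x s hs E hE hEm hEs
  have hr' := ENNReal.toReal_pos hr0 hr
  have hP := hΦ.pos (inv_pos.2 hs).le
  set A := ulAvgZygmundNorm Φ r α R φ
  set I := ∫⁻ τ in Set.Ioo 0 s, rearr (fun y => |(Metric.ball x R).indicator φ y| ^ r.toReal) τ
  have h1 : ∫⁻ y in E, ‖φ y‖ₑ ^ r.toReal ≤ I := by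
    refine le_trans (le_of_eq ?_) (setLIntegral_le_lintegral_rearr
      ((hφ.indicator measurableSet_ball).abs.pow_const _) hEs)
    exact setLIntegral_congr_fun hEm fun y hy => (enorm_abs_indicator_rpow _ _ hr'.le (hE hy)).symm
  have h2 : ENNReal.ofReal (Φ s⁻¹ ^ α) * I ≤ A ^ r.toReal := by
    rw [← mul_rearrAvg hs]
    refine (le_avgZygmundNorm hr0 hr hs).trans (ENNReal.rpow_le_rpow ?_ hr'.le)
    exact le_iSup (fun x => avgZygmundNorm Φ r α ((Metric.ball x R).indicator φ)) x
  have h3 : ENNReal.ofReal s * (A * ENNReal.ofReal (zygmundProfile Φ r⁻¹.toReal α s)) ^ r.toReal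
      = ENNReal.ofReal (Φ s⁻¹ ^ α)⁻¹ * A ^ r.toReal := by
    rw [ENNReal.mul_rpow_of_nonneg _ _ hr'.le,
      ENNReal.ofReal_rpow_of_pos (hΦ.zygmundProfile_pos _ _ hs), hΦ.zygmundProfile_rpow _ _ _ hs,
      toReal_inv_mul_toReal hr0 hr, mul_left_comm, ← ENNReal.ofReal_mul hs.le, mul_comm]
    congr 2
    rw [mul_one, Real.rpow_neg_one, mul_inv_cancel_left₀ hs.ne', Real.rpow_neg hP.le]
  refine h1.trans ?_
  simp only [h3]
  calc I = ENNReal.ofReal (Φ s⁻¹ ^ α)⁻¹ * (ENNReal.ofReal (Φ s⁻¹ ^ α) * I) := by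
        rw [← mul_assoc, ← ENNReal.ofReal_mul (by positivity), inv_mul_cancel₀ (by positivity),
          ENNReal.ofReal_one, one_mul]
    _ ≤ _ := by gcongr

theorem rearr_le_weakZygmundNorm_mul {N : ℕ} {Φ : ℝ → ℝ} (hΦ : IsZygmundWeight Φ) {r : ℝ≥0∞}
    (hr0 : r ≠ 0) (hr : r ≠ ∞) (α : ℝ) (f : EuclideanSpace ℝ (Fin N) → ℝ) {s : ℝ} (hs : 0 < s) :
    rearr f s ≤ weakZygmundNorm Φ r α f
      * ENNReal.ofReal (zygmundProfile Φ r⁻¹.toReal α s) := by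
  have hr' := ENNReal.toReal_pos hr0 hr
  have hP := hΦ.pos (inv_pos.2 hs).le
  rw [← ENNReal.rpow_le_rpow_iff hr', ENNReal.mul_rpow_of_nonneg _ _ hr'.le,
    ENNReal.ofReal_rpow_of_pos (hΦ.zygmundProfile_pos _ _ hs), hΦ.zygmundProfile_rpow _ _ _ hs,
    toReal_inv_mul_toReal hr0 hr, mul_one, Real.rpow_neg_one, Real.rpow_neg hP.le, ← mul_inv]
  calc rearr f s ^ r.toReal = ENNReal.ofReal (s * Φ s⁻¹ ^ α)⁻¹ *
        (ENNReal.ofReal (s * Φ s⁻¹ ^ α) * rearr f s ^ r.toReal) := by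
        rw [← mul_assoc, ← ENNReal.ofReal_mul (by positivity), inv_mul_cancel₀ (by positivity),
          ENNReal.ofReal_one, one_mul]
    _ ≤ _ := by
        rw [mul_comm]
        gcongr
        exact le_weakZygmundNorm hr0 hr hs

/-- The factor `Φ(τ⁻¹)^{-αq}` is non-decreasing in `τ`, so its value at `s` dominates; what remains
is `τ^{-q}` with `q < 1`. -/
theorem lintegral_zygmundProfile_le {Φ : ℝ → ℝ} (hΦ : IsZygmundWeight Φ) {q α : ℝ} (hq0 : 0 ≤ q)
    (hq : q < 1) (hα : 0 ≤ α) {s : ℝ} (hs : 0 < s) (A : ℝ≥0∞) :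
    ∫⁻ τ in Set.Ioo 0 s, A * ENNReal.ofReal (zygmundProfile Φ q α τ)
      ≤ ENNReal.ofReal s * (ENNReal.ofReal (1 / (1 - q)) * A
        * ENNReal.ofReal (zygmundProfile Φ q α s)) := by
  have hP := hΦ.pos (inv_pos.2 hs).le
  set c := Φ s⁻¹ ^ (-(α * q)) with hc
  have hc0 : 0 < c := by positivity
  have hq1 : 0 < 1 - q := by linarith
  have hi : IntervalIntegrable (fun τ : ℝ => τ ^ (-q)) volume 0 s :=
    intervalIntegral.intervalIntegrable_rpow' (by linarith)
  have hint : ∫⁻ τ in Set.Ioo 0 s, ENNReal.ofReal (τ ^ (-q))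
      = ENNReal.ofReal (s ^ (1 - q) / (1 - q)) := by
    have h1 := integral_rpow (a := 0) (b := s) (r := -q) (Or.inl (by linarith))
    rw [intervalIntegral.integral_of_le hs.le, Real.zero_rpow (by linarith), sub_zero,
      show -q + 1 = 1 - q by ring] at h1
    rw [← h1, ofReal_integral_eq_lintegral_ofReal
      ((intervalIntegrable_iff_integrableOn_Ioc_of_le hs.le).1 hi)]
    · exact setLIntegral_congr Ioo_ae_eq_Ioc
    · refine (ae_restrict_iff' measurableSet_Ioc).2 (Filter.Eventually.of_forall fun τ hτ => ?_)
      exact Real.rpow_nonneg hτ.1.le _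
  calc ∫⁻ τ in Set.Ioo 0 s, A * ENNReal.ofReal (zygmundProfile Φ q α τ)
      ≤ ∫⁻ τ in Set.Ioo 0 s, A * ENNReal.ofReal c * ENNReal.ofReal (τ ^ (-q)) := by
        refine setLIntegral_mono' measurableSet_Ioo fun τ hτ => ?_
        rw [mul_assoc, ← ENNReal.ofReal_mul hc0.le, zygmundProfile, mul_comm c]
        refine mul_le_mul' le_rfl (ENNReal.ofReal_le_ofReal ?_)
        refine mul_le_mul_of_nonneg_left ?_ (Real.rpow_nonneg hτ.1.le _)
        exact Real.rpow_le_rpow_of_nonpos hP (hΦ.inv_le_inv hτ.1 hτ.2.le)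
          (neg_nonpos.2 (mul_nonneg hα hq0))
    _ = A * ENNReal.ofReal (c * (s ^ (1 - q) / (1 - q))) := by
        rw [lintegral_const_mul _ (by fun_prop), hint, ENNReal.ofReal_mul hc0.le, mul_assoc]
    _ = _ := by
        rw [mul_right_comm, ← ENNReal.ofReal_mul (by positivity), ← mul_assoc,
          ← ENNReal.ofReal_mul hs.le, mul_comm]
        congr 2
        rw [zygmundProfile, ← hc, Real.rpow_sub hs, Real.rpow_one, Real.rpow_neg hs.le]
        field_simp

/-- The weak norm need not control `∫ |φ|^r`, but for `r > 1` it controls `∫ |φ|`. The trivial power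
`1` keeps the shape shared with the averaged case. -/
theorem massBound_ulWeakZygmundNorm {N : ℕ} {Φ : ℝ → ℝ} (hΦ : IsZygmundWeight Φ) {r : ℝ≥0∞}
    (hr : 1 < r) {α : ℝ} (hα : 0 ≤ α) (R : ℝ) {φ : EuclideanSpace ℝ (Fin N) → ℝ}
    (hφ : AEMeasurable φ) :
    MassBound (fun y => ‖φ y‖ₑ ^ (1 : ℝ)) R fun s => ENNReal.ofReal s *
      (ENNReal.ofReal (1 / (1 - r⁻¹.toReal)) * ulWeakZygmundNorm Φ r α R φ
        * ENNReal.ofReal (zygmundProfile Φ r⁻¹.toReal α s)) ^ (1 : ℝ) := by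
  intro x s hs E hE hEm hEs
  simp only [ENNReal.rpow_one]
  set B := Metric.ball x R
  have hA : weakZygmundNorm Φ r α (B.indicator φ) ≤ ulWeakZygmundNorm Φ r α R φ :=
    le_iSup (fun x => weakZygmundNorm Φ r α ((Metric.ball x R).indicator φ)) x
  set A := ulWeakZygmundNorm Φ r α R φ
  have hEB : ∫⁻ y in E, ‖φ y‖ₑ = ∫⁻ y in E, ‖B.indicator φ y‖ₑ :=
    setLIntegral_congr_fun hEm fun y hy => by rw [Set.indicator_of_mem (hE hy)]
  rw [hEB]
  by_cases hrt : r = ∞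
  · subst hrt
    rw [weakZygmundNorm, if_pos rfl] at hA
    have h0 : zygmundProfile Φ (∞ : ℝ≥0∞)⁻¹.toReal α s = 1 := by simp [zygmundProfile]
    rw [h0]
    simp only [ENNReal.inv_top, ENNReal.toReal_zero, sub_zero, div_one, ENNReal.ofReal_one,
      one_mul, mul_one]
    calc ∫⁻ y in E, ‖B.indicator φ y‖ₑ ≤ ∫⁻ y in E, A := by
          refine lintegral_mono_ae (ae_restrict_of_ae ?_)
          rw [eLpNorm_exponent_top] at hA
          filter_upwards [enorm_ae_le_eLpNormEssSup (B.indicator φ) volume] with y hy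
          exact hy.trans hA
      _ = A * volume E := by rw [setLIntegral_const]
      _ ≤ _ := by rw [mul_comm]; gcongr
  · have hr0 : r ≠ 0 := (zero_lt_one.trans hr).ne'
    have hq : r⁻¹.toReal < 1 := by
      rw [ENNReal.toReal_inv]
      refine inv_lt_one_of_one_lt₀ ?_
      rw [← ENNReal.toReal_one]
      exact (ENNReal.toReal_lt_toReal ENNReal.one_ne_top hrt).2 hr
    calc ∫⁻ y in E, ‖B.indicator φ y‖ₑ ≤ ∫⁻ τ in Set.Ioo 0 s, rearr (B.indicator φ) τ :=
          setLIntegral_le_lintegral_rearr (hφ.indicator measurableSet_ball) hEs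
      _ ≤ ∫⁻ τ in Set.Ioo 0 s, A * ENNReal.ofReal (zygmundProfile Φ r⁻¹.toReal α τ) := by
          refine setLIntegral_mono' measurableSet_Ioo fun τ hτ => ?_
          refine (rearr_le_weakZygmundNorm_mul hΦ hr0 hrt α _ hτ.1).trans ?_
          gcongr
      _ ≤ _ := lintegral_zygmundProfile_le hΦ ENNReal.toReal_nonneg hq hα hs A

/-! ### From mass bounds to norms of the solution -/

/-- For a level just above `M = P(s)^p`, which dominates `g*(s)`, the part of `∫ g*` below it is
about `sM`; the level set has measure at most `s`, so the mass bound gives another `sM`. Hence the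
factor `2`. -/
theorem MassBound.rearrAvg_le {N : ℕ} (hN : 1 ≤ N) {u : EuclideanSpace ℝ (Fin N) → ℝ}
    (hu : Measurable u) {R p : ℝ} (hp : 0 < p) {P : ℝ → ℝ≥0∞}
    (h : MassBound (fun y => ‖u y‖ₑ ^ p) R fun s => ENNReal.ofReal s * P s ^ p)
    (x : EuclideanSpace ℝ (Fin N)) {s : ℝ} (hs : 0 < s) :
    rearrAvg (fun y => |(Metric.ball x R).indicator u y| ^ p) s ≤ 2 * P s ^ p := by
  set B := Metric.ball x R
  set g := fun y => |B.indicator u y| ^ p with hg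
  have hgm : Measurable g := (hu.indicator measurableSet_ball).abs.pow_const p
  have hs0 : ENNReal.ofReal s ≠ 0 := by simpa using hs
  refine _root_.rearrAvg_le hs ?_
  have hrearr : rearr g s ≤ P s ^ p := by
    rw [hg, rearr_abs_rpow _ hp]
    exact ENNReal.rpow_le_rpow (h.rearr_le hN hu hp x hs) hp.le
  set M := P s ^ p with hM
  set I := ∫⁻ τ in Set.Ioo 0 s, rearr g τ
  have key : ∀ c, M < c → I ≤ ENNReal.ofReal s * c + ENNReal.ofReal s * M := by
    intro c hc
    obtain ⟨l, hl, hlc⟩ := ENNReal.lt_iff_exists_nnreal_btwn.1 hc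
    rw [← ENNReal.ofReal_coe_nnreal] at hl hlc
    have hl0 : (0 : ℝ) < l := ENNReal.ofReal_pos.1 (lt_of_le_of_lt zero_le hl)
    refine (lintegral_rearr_le hgm s hl0).trans ?_
    gcongr
    have hsub : {y | (l : ℝ) < |g y|} ⊆ B := by
      intro y hy
      by_contra hyB
      rw [Set.mem_ofPred_eq, hg] at hy
      simp only [Set.indicator_of_notMem hyB, abs_zero, Real.zero_rpow hp.ne'] at hy
      exact (hl0.trans hy).false
    have hm : MeasurableSet {y | (l : ℝ) < |g y|} := measurableSet_lt measurable_const hgm.abs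
    refine le_trans (le_of_eq ?_) (h x s hs _ hsub hm
      (distribFun_le_of_rearr_lt (hrearr.trans_lt hl)))
    exact setLIntegral_congr_fun hm fun y hy => enorm_abs_indicator_rpow _ _ hp.le (hsub hy)
  have h1 : (I - ENNReal.ofReal s * M) / ENNReal.ofReal s ≤ M := by
    refine le_of_forall_gt_imp_ge_of_dense fun c hc => ?_
    rw [ENNReal.div_le_iff hs0 ENNReal.ofReal_ne_top, tsub_le_iff_right, mul_comm c]
    exact key c hc
  rw [ENNReal.div_le_iff hs0 ENNReal.ofReal_ne_top, tsub_le_iff_right] at h1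
  refine h1.trans (le_of_eq ?_)
  ring

/-- Bounds for `S(t)φ` on every ball of radius `R`: decay of the rearrangement, boundedness, and
decay of the averaged rearrangement. -/
theorem exists_heatSemigroup_bounds {N : ℕ} (hN : 1 ≤ N) : ∃ C : ℝ, 0 < C ∧
    ∀ (φ : EuclideanSpace ℝ (Fin N) → ℝ), AEMeasurable φ → ∀ (p R t : ℝ) (A : ℝ≥0∞) (P : ℝ → ℝ),
      1 ≤ p → 0 < R → 0 < t → t < R ^ 2 →
      MassBound (fun y => ‖φ y‖ₑ ^ p) R
        (fun s => ENNReal.ofReal s * (A * ENNReal.ofReal (P s)) ^ p) →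
      (∀ x s, 0 < s → rearr ((Metric.ball x R).indicator (heatSemigroup t φ)) s
        ≤ ENNReal.ofReal C * A * ENNReal.ofReal (P s)) ∧
      (∀ x, ‖heatSemigroup t φ x‖ₑ
        ≤ ENNReal.ofReal C * A * ENNReal.ofReal (P (t ^ ((N : ℝ) / 2)))) ∧
      (∀ x s, 0 < s →
        rearrAvg (fun y => |(Metric.ball x R).indicator (heatSemigroup t φ) y| ^ p) s
          ≤ (ENNReal.ofReal C * A * ENNReal.ofReal (P s)) ^ p) := by
  obtain ⟨C, hC, h⟩ := exists_enorm_heatSemigroup_le hN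
  -- The factor `2` of the averaged bound fits inside the power, since `2 ≤ 2^p ≤ (2C)^p`.
  refine ⟨2 * C, by linarith, fun φ hφ p R t A P hp hR ht htR hmass => ?_⟩
  have hp0 : 0 < p := by linarith
  -- Integrals ignore null sets, so passing to a measurable representative changes `S(t)φ` at no
  -- point.
  have heq : heatSemigroup t φ = heatSemigroup t (hφ.mk φ) := by
    ext x
    refine integral_congr_ae ?_
    filter_upwards [hφ.ae_eq_mk] with y hy
    rw [hy]
  have hmass' : MassBound (fun y => ‖hφ.mk φ y‖ₑ ^ p) R
      (fun s => ENNReal.ofReal s * (A * ENNReal.ofReal (P s)) ^ p) := by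
    refine hmass.congr_ae ?_
    filter_upwards [hφ.ae_eq_mk] with y hy
    rw [hy]
  have hu := measurable_heatSemigroup t hφ.measurable_mk
  have hmu := massBound_heatSemigroup ht hp hφ.measurable_mk hmass'
  rw [heq]
  have h2C : (2 : ℝ≥0∞) ≤ ENNReal.ofReal (2 * C) := by
    rw [← ENNReal.ofReal_ofNat 2]
    exact ENNReal.ofReal_le_ofReal (by linarith)
  have h1C : (1 : ℝ≥0∞) ≤ ENNReal.ofReal (2 * C) := one_le_two.trans h2C
  refine ⟨fun x s hs => ?_, fun x => ?_, fun x s hs => ?_⟩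
  · refine (hmu.rearr_le hN hu hp0 x hs).trans ?_
    rw [mul_assoc]
    exact le_mul_of_one_le_left zero_le h1C
  · refine (h _ hφ.measurable_mk p R t (fun s => A * ENNReal.ofReal (P s)) hp hR ht htR
      hmass' x).trans ?_
    rw [mul_assoc]
    exact mul_le_mul' (ENNReal.ofReal_le_ofReal (by linarith)) le_rfl
  · refine (hmu.rearrAvg_le hN hu hp0 x hs).trans ?_
    rw [mul_assoc, ENNReal.mul_rpow_of_nonneg (ENNReal.ofReal (2 * C)) _ hp0.le]
    refine mul_le_mul' ?_ le_rfl
    calc (2 : ℝ≥0∞) = 2 ^ (1 : ℝ) := (ENNReal.rpow_one 2).symm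
      _ ≤ 2 ^ p := ENNReal.rpow_le_rpow_of_exponent_le one_le_two hp
      _ ≤ _ := ENNReal.rpow_le_rpow h2C hp0.le

theorem ulWeakZygmundNorm_top_le {N : ℕ} {Φ : ℝ → ℝ} {q α β R T : ℝ} {A : ℝ≥0∞}
    {u : EuclideanSpace ℝ (Fin N) → ℝ}
    (hu : ∀ x, ‖u x‖ₑ ≤ A * ENNReal.ofReal (zygmundProfile Φ q α T)) :
    ulWeakZygmundNorm Φ ∞ β R u
      ≤ A * ENNReal.ofReal (volumeRate Φ q (∞ : ℝ≥0∞)⁻¹.toReal α β T) := by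
  have : volumeRate Φ q (∞ : ℝ≥0∞)⁻¹.toReal α β T = zygmundProfile Φ q α T := by
    simp [volumeRate, zygmundProfile]
  rw [this]
  refine iSup_le fun x => ?_
  rw [weakZygmundNorm, if_pos rfl, eLpNorm_exponent_top]
  refine eLpNormEssSup_le_of_ae_enorm_bound (Filter.Eventually.of_forall fun y => ?_)
  exact (enorm_indicator_le_enorm_self _ _).trans (hu y)

theorem exists_ulAvgZygmundNorm_le_of_lt {N : ℕ} {Φ : ℝ → ℝ} (hΦ : IsZygmundWeight Φ)
    {r₁ r₂ : ℝ≥0∞} (hr₁ : 1 ≤ r₁) (hr : r₁ < r₂) {α β : ℝ} (hα : 0 ≤ α) (hβ : 0 ≤ β) :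
    ∃ C : ℝ, 0 < C ∧ ∀ (u : EuclideanSpace ℝ (Fin N) → ℝ) (R T : ℝ) (A : ℝ≥0∞), 0 < T →
      (∀ x s, 0 < s → rearr ((Metric.ball x R).indicator u) s
        ≤ A * ENNReal.ofReal (zygmundProfile Φ r₁⁻¹.toReal α s)) →
      (∀ x, ‖u x‖ₑ ≤ A * ENNReal.ofReal (zygmundProfile Φ r₁⁻¹.toReal α T)) →
      ulAvgZygmundNorm Φ r₂ β R u
        ≤ A * ENNReal.ofReal (C * volumeRate Φ r₁⁻¹.toReal r₂⁻¹.toReal α β T) := by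
  by_cases hr₂ : r₂ = ∞
  · subst hr₂
    refine ⟨1, one_pos, fun u R T A hT _ h2 => ?_⟩
    rw [one_mul, ulAvgZygmundNorm_top]
    exact ulWeakZygmundNorm_top_le h2
  have hr₂0 : r₂ ≠ 0 := ((zero_lt_one.trans_le hr₁).trans hr).ne'
  have hr₁0 : r₁ ≠ 0 := (zero_lt_one.trans_le hr₁).ne'
  have hr₁t : r₁ ≠ ∞ := hr.ne_top
  set q := r₁⁻¹.toReal with hq
  set r := r₂.toReal with hrr
  have hr0 : 0 < r := ENNReal.toReal_pos hr₂0 hr₂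
  have hq0 : 0 ≤ q := ENNReal.toReal_nonneg
  have hm : 1 < q * r := by
    rw [← toReal_inv_mul_toReal hr₁0 hr₁t]
    refine mul_lt_mul_of_pos_left ((ENNReal.toReal_lt_toReal hr₁t hr₂).2 hr) ?_
    exact ENNReal.toReal_pos (ENNReal.inv_ne_zero.2 hr₁t) (ENNReal.inv_ne_top.2 hr₁0)
  obtain ⟨C, hC, h⟩ := hΦ.exists_lintegral_le (γ := α * (q * r)) hm
    (mul_nonneg hα (by linarith)) hβ
  refine ⟨C ^ r⁻¹, by positivity, fun u R T A hT h1 h2 => ?_⟩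
  have hV := hΦ.volumeRate_pos q r₂⁻¹.toReal α β hT
  -- The integral estimate needs a finite factor. Nothing here bounds `A`: membership in the space
  -- is finiteness at radius one, while the estimate is used at radius `R`.
  by_cases hA : A = ∞
  · have hpos : 0 < C ^ r⁻¹ * volumeRate Φ q r₂⁻¹.toReal α β T := by positivity
    rw [hA, ENNReal.top_mul (ENNReal.ofReal_pos.2 hpos).ne']
    exact le_top
  have hpow : ∀ τ, 0 < τ → (A * ENNReal.ofReal (zygmundProfile Φ q α τ)) ^ r
      = A ^ r * ENNReal.ofReal (τ ^ (-(q * r)) * Φ τ⁻¹ ^ (-(α * (q * r)))) := by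
    intro τ hτ
    rw [ENNReal.mul_rpow_of_nonneg _ _ hr0.le,
      ENNReal.ofReal_rpow_of_pos (hΦ.zygmundProfile_pos _ _ hτ), hΦ.zygmundProfile_rpow _ _ _ hτ]
  refine iSup_le fun x => avgZygmundNorm_le hr₂0 hr₂ fun s hs => ?_
  rw [← hrr, mul_rearrAvg hs]
  simp_rw [rearr_abs_rpow _ hr0]
  refine (h T s (A ^ r) _ hT hs (ENNReal.rpow_ne_top_of_nonneg hr0.le hA) (fun τ hτ => ?_)
    (fun τ hτ => ?_)).trans (le_of_eq ?_)
  · rw [← hpow τ hτ]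
    exact ENNReal.rpow_le_rpow (h1 x τ hτ) hr0.le
  · rw [← hpow T hT]
    refine ENNReal.rpow_le_rpow (rearr_le_of_enorm_le (fun y => ?_) τ) hr0.le
    exact (enorm_indicator_le_enorm_self _ _).trans (h2 y)
  · rw [ENNReal.mul_rpow_of_nonneg _ _ hr0.le, ENNReal.ofReal_rpow_of_pos (by positivity),
      Real.mul_rpow (by positivity) hV.le, Real.rpow_inv_rpow hC.le hr0.ne',
      hΦ.volumeRate_rpow _ _ _ _ _ hT,
      show r₂⁻¹.toReal * r = 1 from toReal_inv_mul_toReal hr₂0 hr₂, mul_one]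

/-- `Y` stands for either `u*(s)^r` or `(|u|^r)**(s)`, so one estimate serves both norms. The
minimum of the two real bounds carries it from `ℝ≥0∞` to `exists_mul_le`. -/
theorem exists_ofReal_mul_le {Φ : ℝ → ℝ} (hΦ : IsZygmundWeight Φ) {r : ℝ≥0∞} (hr0 : r ≠ 0)
    (hr : r ≠ ∞) {α β : ℝ} (hα : 0 ≤ α) (hαβ : α ≤ β) :
    ∃ C : ℝ, 0 < C ∧ ∀ (T s : ℝ) (A Y : ℝ≥0∞), 0 < T → 0 < s →
      Y ≤ (A * ENNReal.ofReal (zygmundProfile Φ r⁻¹.toReal α s)) ^ r.toReal →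
      Y ≤ (A * ENNReal.ofReal (zygmundProfile Φ r⁻¹.toReal α T)) ^ r.toReal →
      ENNReal.ofReal (s * Φ s⁻¹ ^ β) * Y
        ≤ (A * ENNReal.ofReal (C * volumeRate Φ r⁻¹.toReal r⁻¹.toReal α β T)) ^ r.toReal := by
  obtain ⟨C, hC, h⟩ := hΦ.exists_mul_le hα hαβ
  have hr' := ENNReal.toReal_pos hr0 hr
  refine ⟨C ^ r.toReal⁻¹, by positivity, fun T s A Y hT hs hYs hYT => ?_⟩
  have hV := hΦ.volumeRate_pos r⁻¹.toReal r⁻¹.toReal α β hT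
  have hP := hΦ.pos (inv_pos.2 hs).le
  have hpow : ∀ τ, 0 < τ → (A * ENNReal.ofReal (zygmundProfile Φ r⁻¹.toReal α τ)) ^ r.toReal
      = A ^ r.toReal * ENNReal.ofReal (τ ^ (-1 : ℝ) * Φ τ⁻¹ ^ (-α)) := by
    intro τ hτ
    rw [ENNReal.mul_rpow_of_nonneg _ _ hr'.le,
      ENNReal.ofReal_rpow_of_pos (hΦ.zygmundProfile_pos _ _ hτ), hΦ.zygmundProfile_rpow _ _ _ hτ,
      toReal_inv_mul_toReal hr0 hr, mul_one]
  rw [hpow s hs] at hYs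
  rw [hpow T hT] at hYT
  set a := s ^ (-1 : ℝ) * Φ s⁻¹ ^ (-α)
  set b := T ^ (-1 : ℝ) * Φ T⁻¹ ^ (-α)
  have hY : Y ≤ A ^ r.toReal * ENNReal.ofReal (min a b) := by
    rcases min_choice a b with hab | hab <;> rw [hab] <;> assumption
  calc ENNReal.ofReal (s * Φ s⁻¹ ^ β) * Y
      ≤ ENNReal.ofReal (s * Φ s⁻¹ ^ β) * (A ^ r.toReal * ENNReal.ofReal (min a b)) := by gcongr
    _ = A ^ r.toReal * ENNReal.ofReal (s * Φ s⁻¹ ^ β * min a b) := by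
        rw [mul_left_comm, ← ENNReal.ofReal_mul (by positivity)]
    _ ≤ A ^ r.toReal * ENNReal.ofReal (C * Φ T⁻¹ ^ (-α + β)) :=
        mul_le_mul' le_rfl (ENNReal.ofReal_le_ofReal
          (h T s _ hT hs (min_le_left _ _) (min_le_right _ _)))
    _ = _ := by
        rw [ENNReal.mul_rpow_of_nonneg _ _ hr'.le, ENNReal.ofReal_rpow_of_pos (by positivity),
          Real.mul_rpow (by positivity) hV.le, Real.rpow_inv_rpow hC.le hr'.ne',
          hΦ.volumeRate_rpow _ _ _ _ _ hT, toReal_inv_mul_toReal hr0 hr]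
        simp

theorem exists_ulWeakZygmundNorm_le {N : ℕ} {Φ : ℝ → ℝ} (hΦ : IsZygmundWeight Φ)
    {r : ℝ≥0∞} (hr0 : r ≠ 0) {α β : ℝ} (hα : 0 ≤ α) (hαβ : α ≤ β) :
    ∃ C : ℝ, 0 < C ∧ ∀ (u : EuclideanSpace ℝ (Fin N) → ℝ) (R T : ℝ) (A : ℝ≥0∞), 0 < T →
      (∀ x s, 0 < s → rearr ((Metric.ball x R).indicator u) s
        ≤ A * ENNReal.ofReal (zygmundProfile Φ r⁻¹.toReal α s)) →
      (∀ x, ‖u x‖ₑ ≤ A * ENNReal.ofReal (zygmundProfile Φ r⁻¹.toReal α T)) →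
      ulWeakZygmundNorm Φ r β R u
        ≤ A * ENNReal.ofReal (C * volumeRate Φ r⁻¹.toReal r⁻¹.toReal α β T) := by
  by_cases hr : r = ∞
  · subst hr
    refine ⟨1, one_pos, fun u R T A hT _ h2 => ?_⟩
    rw [one_mul]
    exact ulWeakZygmundNorm_top_le h2
  obtain ⟨C, hC, h⟩ := exists_ofReal_mul_le hΦ hr0 hr hα hαβ
  refine ⟨C, hC, fun u R T A hT h1 h2 => iSup_le fun x =>
    weakZygmundNorm_le hr0 hr fun s hs => h T s A _ hT hs ?_ ?_⟩
  · exact ENNReal.rpow_le_rpow (h1 x s hs) ENNReal.toReal_nonneg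
  · refine ENNReal.rpow_le_rpow (rearr_le_of_enorm_le (fun y => ?_) s) ENNReal.toReal_nonneg
    exact (enorm_indicator_le_enorm_self _ _).trans (h2 y)

/-- The averaged rearrangement is a hypothesis here because at equal exponents the bound on `u*`
behaves like `τ⁻¹` at infinity, and integrating it would cost a logarithm. -/
theorem exists_ulAvgZygmundNorm_le {N : ℕ} {Φ : ℝ → ℝ} (hΦ : IsZygmundWeight Φ)
    {r : ℝ≥0∞} (hr0 : r ≠ 0) {α β : ℝ} (hα : 0 ≤ α) (hαβ : α ≤ β) :
    ∃ C : ℝ, 0 < C ∧ ∀ (u : EuclideanSpace ℝ (Fin N) → ℝ) (R T : ℝ) (A : ℝ≥0∞), 0 < T →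
      (r ≠ ∞ → ∀ x s, 0 < s →
        rearrAvg (fun y => |(Metric.ball x R).indicator u y| ^ r.toReal) s
          ≤ (A * ENNReal.ofReal (zygmundProfile Φ r⁻¹.toReal α s)) ^ r.toReal) →
      (∀ x, ‖u x‖ₑ ≤ A * ENNReal.ofReal (zygmundProfile Φ r⁻¹.toReal α T)) →
      ulAvgZygmundNorm Φ r β R u
        ≤ A * ENNReal.ofReal (C * volumeRate Φ r⁻¹.toReal r⁻¹.toReal α β T) := by
  by_cases hr : r = ∞
  · subst hr
    refine ⟨1, one_pos, fun u R T A hT _ h2 => ?_⟩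
    rw [one_mul, ulAvgZygmundNorm_top]
    exact ulWeakZygmundNorm_top_le h2
  obtain ⟨C, hC, h⟩ := exists_ofReal_mul_le hΦ hr0 hr hα hαβ
  refine ⟨C, hC, fun u R T A hT h1 h2 => iSup_le fun x =>
    avgZygmundNorm_le hr0 hr fun s hs => h T s A _ hT hs (h1 hr x s hs) (rearrAvg_le hs ?_)⟩
  have hr' := ENNReal.toReal_pos hr0 hr
  simp_rw [rearr_abs_rpow _ hr']
  calc ∫⁻ τ in Set.Ioo 0 s, rearr ((Metric.ball x R).indicator u) τ ^ r.toReal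
      ≤ ∫⁻ τ in Set.Ioo 0 s,
          (A * ENNReal.ofReal (zygmundProfile Φ r⁻¹.toReal α T)) ^ r.toReal := by
        refine lintegral_mono fun τ => ENNReal.rpow_le_rpow
          (rearr_le_of_enorm_le (fun y => ?_) τ) hr'.le
        exact (enorm_indicator_le_enorm_self _ _).trans (h2 y)
    _ = _ := by rw [setLIntegral_const, Real.volume_Ioo, sub_zero, mul_comm]

/-! ### The main estimates -/

theorem heatIntegrable_of_massBound {N : ℕ} {φ : EuclideanSpace ℝ (Fin N) → ℝ}
    (hφ : AEMeasurable φ) {p R t : ℝ} {A : ℝ≥0∞} {P : ℝ → ℝ} (hp : 1 ≤ p) (hR : 0 < R)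
    (ht : 0 < t) (hA : A ≠ ∞) (h : MassBound (fun y => ‖φ y‖ₑ ^ p) R
      fun s => ENNReal.ofReal s * (A * ENNReal.ofReal (P s)) ^ p) :
    HeatIntegrable t φ := by
  have hmass : MassBound (fun y => ‖hφ.mk φ y‖ₑ ^ p) R
      (fun s => ENNReal.ofReal s * (A * ENNReal.ofReal (P s)) ^ p) := by
    refine h.congr_ae ?_
    filter_upwards [hφ.ae_eq_mk] with y hy
    rw [hy]
  intro x
  refine (hmass.heatIntegrable hφ.measurable_mk hp hR ht (fun s _ => ?_) x).congr ?_
  · exact ENNReal.mul_ne_top ENNReal.ofReal_ne_top (ENNReal.rpow_ne_top_of_nonneg (by linarith)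
      (ENNReal.mul_ne_top hA ENNReal.ofReal_ne_top))
  · filter_upwards [hφ.ae_eq_mk] with y hy
    rw [hy]

theorem mul_ofReal_le_ofReal_mul {C k c c' v d : ℝ} {n : ℝ≥0∞} (hC : 0 < C) (hk : 0 < k)
    (hc : 0 < c) (hv : v ≤ c' * d) :
    ENNReal.ofReal C * (ENNReal.ofReal k * n) * ENNReal.ofReal (c * v)
      ≤ ENNReal.ofReal (C * k * c * c' * d) * n := by
  calc ENNReal.ofReal C * (ENNReal.ofReal k * n) * ENNReal.ofReal (c * v)
      ≤ ENNReal.ofReal C * (ENNReal.ofReal k * n) * ENNReal.ofReal (c * (c' * d)) := by gcongr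
    _ = _ := by
        rw [show C * k * c * c' * d = C * (k * (c * (c' * d))) by ring,
          ENNReal.ofReal_mul hC.le, ENNReal.ofReal_mul hk.le]
        ring

theorem one_sub_inv_toReal_pos {r : ℝ≥0∞} (hr : 1 < r) : 0 < 1 / (1 - r⁻¹.toReal) := by
  have : r⁻¹.toReal < 1 := by
    rw [← ENNReal.toReal_one]
    refine (ENNReal.toReal_lt_toReal ?_ ENNReal.one_ne_top).2 (ENNReal.inv_lt_one.2 hr)
    exact ENNReal.inv_ne_top.2 (zero_lt_one.trans hr).ne'
  exact one_div_pos.2 (by linarith)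

theorem proposition3p2 (N : ℕ) (hN : 1 ≤ N) (Φ : ℝ → ℝ) (hΦ : IsZygmundWeight Φ)
    (r₁ r₂ : ℝ≥0∞) (hr₁ : 1 ≤ r₁) (hr : r₁ ≤ r₂) (α β : ℝ) (hα : 0 ≤ α) (hβ : 0 ≤ β)
    (hαβ : r₁ = r₂ → α ≤ β) (Rstar : ℝ) (hRstar : 0 < Rstar) :
    (∃ C₁ : ℝ, 0 < C₁ ∧ ∀ φ : EuclideanSpace ℝ (Fin N) → ℝ, MemUlAvgZygmund Φ r₁ α φ →
      ∀ R t : ℝ, 0 < R → R ≤ Rstar → 0 < t → t < R ^ 2 →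
        HeatIntegrable t φ ∧
        ulAvgZygmundNorm Φ r₂ β R (heatSemigroup t φ) ≤
          ENNReal.ofReal (C₁ * decayRate N Φ r₁ r₂ α β t) * ulAvgZygmundNorm Φ r₁ α R φ) ∧
    (1 < r₁ →
      ∃ C₂ : ℝ, 0 < C₂ ∧ ∀ φ : EuclideanSpace ℝ (Fin N) → ℝ, MemUlWeakZygmund Φ r₁ α φ →
      ∀ R t : ℝ, 0 < R → R ≤ Rstar → 0 < t → t < R ^ 2 →
        HeatIntegrable t φ ∧
        ulWeakZygmundNorm Φ r₂ β R (heatSemigroup t φ) ≤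
          ENNReal.ofReal (C₂ * decayRate N Φ r₁ r₂ α β t) * ulWeakZygmundNorm Φ r₁ α R φ) ∧
    (1 < r₁ → r₁ < r₂ →
      ∃ C₃ : ℝ, 0 < C₃ ∧ ∀ φ : EuclideanSpace ℝ (Fin N) → ℝ, MemUlWeakZygmund Φ r₁ α φ →
      ∀ R t : ℝ, 0 < R → R ≤ Rstar → 0 < t → t < R ^ 2 →
        HeatIntegrable t φ ∧
        ulAvgZygmundNorm Φ r₂ β R (heatSemigroup t φ) ≤
          ENNReal.ofReal (C₃ * decayRate N Φ r₁ r₂ α β t) * ulWeakZygmundNorm Φ r₁ α R φ) := by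
  have hr₁0 : r₁ ≠ 0 := (zero_lt_one.trans_le hr₁).ne'
  have hr₂0 : r₂ ≠ 0 := (zero_lt_one.trans_le (hr₁.trans hr)).ne'
  obtain ⟨C, hC, hheat⟩ := exists_heatSemigroup_bounds hN
  obtain ⟨c', hc', hrate⟩ := hΦ.exists_volumeRate_le hN r₁ r₂ α β
  have hT : ∀ t : ℝ, 0 < t → 0 < t ^ ((N : ℝ) / 2) := fun t ht => Real.rpow_pos_of_pos ht _
  have hint : 1 < r₁ → ∀ φ : EuclideanSpace ℝ (Fin N) → ℝ, MemUlWeakZygmund Φ r₁ α φ →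
      ∀ t, 0 < t → HeatIntegrable t φ := fun h1 φ hφ t ht =>
    heatIntegrable_of_massBound hφ.1.aestronglyMeasurable.aemeasurable le_rfl one_pos ht
      (ENNReal.mul_ne_top ENNReal.ofReal_ne_top hφ.2.ne)
      (massBound_ulWeakZygmundNorm hΦ h1 hα 1 hφ.1.aestronglyMeasurable.aemeasurable)
  have part₃ : 1 < r₁ → r₁ < r₂ →
      ∃ C₃ : ℝ, 0 < C₃ ∧ ∀ φ : EuclideanSpace ℝ (Fin N) → ℝ, MemUlWeakZygmund Φ r₁ α φ →
      ∀ R t : ℝ, 0 < R → R ≤ Rstar → 0 < t → t < R ^ 2 →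
        HeatIntegrable t φ ∧
        ulAvgZygmundNorm Φ r₂ β R (heatSemigroup t φ) ≤
          ENNReal.ofReal (C₃ * decayRate N Φ r₁ r₂ α β t) * ulWeakZygmundNorm Φ r₁ α R φ := by
    intro h1 hlt
    have hk := one_sub_inv_toReal_pos h1
    obtain ⟨c, hc, hnorm⟩ := exists_ulAvgZygmundNorm_le_of_lt (N := N) hΦ hr₁ hlt hα hβ
    refine ⟨C * (1 / (1 - r₁⁻¹.toReal)) * c * c', by positivity,
      fun φ hφ R t hR _ ht htR => ⟨hint h1 φ hφ t ht, ?_⟩⟩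
    have hφm := hφ.1.aestronglyMeasurable.aemeasurable
    obtain ⟨b1, b2, -⟩ := hheat φ hφm 1 R t _ _ le_rfl hR ht htR
      (massBound_ulWeakZygmundNorm hΦ h1 hα R hφm)
    exact (hnorm _ R _ _ (hT t ht) b1 b2).trans
      (mul_ofReal_le_ofReal_mul hC hk hc (hrate t ht))
  have part₂ : 1 < r₁ →
      ∃ C₂ : ℝ, 0 < C₂ ∧ ∀ φ : EuclideanSpace ℝ (Fin N) → ℝ, MemUlWeakZygmund Φ r₁ α φ →
      ∀ R t : ℝ, 0 < R → R ≤ Rstar → 0 < t → t < R ^ 2 →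
        HeatIntegrable t φ ∧
        ulWeakZygmundNorm Φ r₂ β R (heatSemigroup t φ) ≤
          ENNReal.ofReal (C₂ * decayRate N Φ r₁ r₂ α β t) * ulWeakZygmundNorm Φ r₁ α R φ := by
    intro h1
    rcases hr.eq_or_lt with heq | hlt
    · have hk := one_sub_inv_toReal_pos h1
      obtain ⟨c, hc, hnorm⟩ := exists_ulWeakZygmundNorm_le (N := N) hΦ hr₁0 hα (hαβ heq)
      refine ⟨C * (1 / (1 - r₁⁻¹.toReal)) * c * c', by positivity,
        fun φ hφ R t hR _ ht htR => ⟨hint h1 φ hφ t ht, ?_⟩⟩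
      have hφm := hφ.1.aestronglyMeasurable.aemeasurable
      obtain ⟨b1, b2, -⟩ := hheat φ hφm 1 R t _ _ le_rfl hR ht htR
        (massBound_ulWeakZygmundNorm hΦ h1 hα R hφm)
      subst heq
      exact (hnorm _ R _ _ (hT t ht) b1 b2).trans
        (mul_ofReal_le_ofReal_mul hC hk hc (hrate t ht))
    · obtain ⟨C₃, hC₃, h⟩ := part₃ h1 hlt
      refine ⟨C₃, hC₃, fun φ hφ R t hR hRs ht htR => ⟨hint h1 φ hφ t ht, ?_⟩⟩
      exact (ulWeakZygmundNorm_le_ulAvgZygmundNorm Φ hr₂0 β R _).trans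
        (h φ hφ R t hR hRs ht htR).2
  refine ⟨?_, part₂, part₃⟩
  -- Then `r₂ = ∞` too, the two norms coincide, and the weak estimate is the claim.
  by_cases hr₁t : r₁ = ∞
  · subst hr₁t
    obtain rfl : r₂ = ∞ := top_le_iff.1 hr
    simpa only [MemUlAvgZygmund, MemUlWeakZygmund, ulAvgZygmundNorm_top]
      using part₂ ENNReal.one_lt_top
  have hp : 1 ≤ r₁.toReal := by
    rw [← ENNReal.toReal_one]
    exact (ENNReal.toReal_le_toReal ENNReal.one_ne_top hr₁t).2 hr₁
  have hint' : ∀ φ : EuclideanSpace ℝ (Fin N) → ℝ, MemUlAvgZygmund Φ r₁ α φ →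
      ∀ t, 0 < t → HeatIntegrable t φ := fun φ hφ t ht =>
    heatIntegrable_of_massBound hφ.1.aestronglyMeasurable.aemeasurable hp one_pos ht hφ.2.ne
      (massBound_ulAvgZygmundNorm hΦ hr₁0 hr₁t α 1 hφ.1.aestronglyMeasurable.aemeasurable)
  -- The averaged mass bound carries no constant; a factor `1` takes the place of `1 / (1 - r₁⁻¹)`
  -- in the bookkeeping.
  have hone : ∀ n : ℝ≥0∞, n = ENNReal.ofReal 1 * n := fun n => by simp
  rcases hr.eq_or_lt with heq | hlt
  · obtain ⟨c, hc, hnorm⟩ := exists_ulAvgZygmundNorm_le (N := N) hΦ hr₁0 hα (hαβ heq)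
    refine ⟨C * 1 * c * c', by positivity, fun φ hφ R t hR _ ht htR => ⟨hint' φ hφ t ht, ?_⟩⟩
    have hφm := hφ.1.aestronglyMeasurable.aemeasurable
    obtain ⟨-, b2, b3⟩ := hheat φ hφm r₁.toReal R t _ _ hp hR ht htR
      (massBound_ulAvgZygmundNorm hΦ hr₁0 hr₁t α R hφm)
    subst heq
    refine (hnorm _ R _ _ (hT t ht) (fun _ => b3) b2).trans ?_
    nth_rewrite 1 [hone (ulAvgZygmundNorm Φ r₁ α R φ)]
    exact mul_ofReal_le_ofReal_mul hC one_pos hc (hrate t ht)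
  · obtain ⟨c, hc, hnorm⟩ := exists_ulAvgZygmundNorm_le_of_lt (N := N) hΦ hr₁ hlt hα hβ
    refine ⟨C * 1 * c * c', by positivity, fun φ hφ R t hR _ ht htR => ⟨hint' φ hφ t ht, ?_⟩⟩
    have hφm := hφ.1.aestronglyMeasurable.aemeasurable
    obtain ⟨b1, b2, -⟩ := hheat φ hφm r₁.toReal R t _ _ hp hR ht htR
      (massBound_ulAvgZygmundNorm hΦ hr₁0 hr₁t α R hφm)
    refine (hnorm _ R _ _ (hT t ht) b1 b2).trans ?_
    nth_rewrite 1 [hone (ulAvgZygmundNorm Φ r₁ α R φ)]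
    exact mul_ofReal_le_ofReal_mul hC one_pos hc (hrate t ht)
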